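/- Let $\ell,m\ge 1$, $I=\{0,\dots,\ell\}$ with indices read modulo $\ell+1$, and let $P=\bigoplus_{i\in I}\mathbb Z\Lambda_i\oplus\mathbb Z\delta$ be the weight lattice of $\widehat{\mathfrak{sl}}_{\ell+1}$, with $\alpha_i^\vee(\Lambda_j)=\delta_{i,j}$, $\alpha_i^\vee(\delta)=0$ and $\alpha_i=2\Lambda_i-\Lambda_{i-1}-\Lambda_{i+1}+\delta_{i,0}\delta$. *The crystal $\widehat B_{\ell,m}$.* Let $B_\ell=\{b_0,\dots,b_\ell\}$ be the crystal with $e_ib_j=\delta_{i,j}b_{j-1}$, $f_ib_j=\delta_{i-1,j}b_i$, $\varepsilon_i(b_j)=\delta_{i,j}$, $\operatorname{wt}b_j=\Lambda_{j+1}-\Lambda_j$, and let $B_\ell(m)=B_\ell^{\otimes m}$, where, with $r^i_k(b)=\varepsilon_i(b_k)-\sum_{j<k}\alpha_i^\vee(\operatorname{wt}b_j)$ for $b=b_1\otimes\cdots\otimes b_m$, one has $\varepsilon_i(b)=\max_k r_k^i(b)$, $\operatorname{wt} b=\sum_k\operatorname{wt} b_k$, and $e_i$ (resp. $f_i$) acts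 on the leftmost (resp. rightmost) factor where the maximum is attained. Let $\widehat B_{\ell,m}=\{b\otimes z^n: b\in B_\ell(m),\ n\in\mathbb Z\}$ with $e_i(b\otimes z^n)=e_ib\otimes z^{n+\delta_{i,0}}$, $f_i(b\otimes z^n)=f_ib\otimes z^{n-\delta_{i,0}}$ (and $0$ where $e_ib=0$, resp. $f_ib=0$), $\varepsilon_i(b\otimes z^n)=\varepsilon_i(b)$, $\operatorname{wt}(b\otimes z^n)=\operatorname{wt}b+n\delta$. For $n\in\mathbb Z$ let $\widehat B^n_{\ell,m}$ be the subcrystal generated by $b_0^{\otimes m}\otimes z^n$ under all $e_i,f_i$. *The path crystal.* Write $[a,b]$ for intervals in $\mathbb Q$. Let $\mathbb P$ be the set of continuous piecewise-linear paths $p:[0,1]\to\mathbb QP$ with $p(0)=0$ and $p(1)\in P$, modulo the equivalence relation generated by $p\circ\theta\sim p$ for $\theta:[0,1]\to[0,1]$ piecewise linear, nondecreasing, continuous and surjective. Put $h^i_p(\tau)=-\alpha_i^\vee(p(\tau))$, $\varepsilon_i(p)=\max(\mathbb Z\cap h^i_p([0,1]))$, $\operatorname{wt}p=p(1)$, and $s_i\lambda=\lambda-\alpha_i^\vee(\lambda)\alpha_i$.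 Let $e_+$ be the first time with $h^i_p=\varepsilon_i(p)$; if $e_+=0$ then $e_ip=0$; otherwise let $e_-$ be the last time in $[0,e_+]$ with $h^i_p=\varepsilon_i(p)-1$, and let $e_ip$ be $p$ on $[0,e_-]$, $s_i(p-p(e_-))+p(e_-)$ on $[e_-,e_+]$, and $p+\alpha_i$ on $[e_+,1]$. Let $f_+$ be the last time with $h^i_p=\varepsilon_i(p)$; if $f_+=1$ then $f_ip=0$; otherwise let $f_-$ be the first time in $[f_+,1]$ with $h^i_p=\varepsilon_i(p)-1$, and let $f_ip$ be $p$ on $[0,f_+]$, $s_i(p-p(f_+))+p(f_+)$ on $[f_+,f_-]$, and $p-\alpha_i$ on $[f_-,1]$. In both crystals $\varphi_i=\varepsilon_i+\alpha_i^\vee\circ\operatorname{wt}$. *The map $\psi$.* For $b=b_{i_m}\otimes\cdots\otimes b_{i_1}\in B_\ell(m)$ let $\{n_1<\dots<n_{k-1}\}=\{r: 1\le r<m,\ i_r>i_{r+1}\}$, $n_0=0$, $n_k=m$, and $N(b)=\sum_{r=1}^k r(n_r-n_{r-1})$. For $1\le s\le m$ let $\rho_s(b)$ be the unique $r\in\{1,\dots,k\}$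 with $n_{r-1}<m-s+1\le n_r$. Put $\kappa_0=0$ and $$\kappa_s=\kappa_{s-1}-(\rho_s(b)-1)+\frac{N(b)+n-m}{m},\qquad 1\le s\le m,$$ and $\lambda_s=\sum_{t=m-s+1}^m\operatorname{wt}b_{i_t}+\kappa_s\delta$ for $0\le s\le m$. Then $\kappa_m=n$, and $\psi(b\otimes z^n)\in\mathbb P$ is the path that equals $\lambda_{s-1}+(m\tau-s+1)(\lambda_s-\lambda_{s-1})$ for $\tau\in[(s-1)/m,s/m]$, $s=1,\dots,m$. **Theorem.** $\widehat B_{\ell,m}$ and $\mathbb P$ are normal crystals, and $\psi:\widehat B_{\ell,m}\to\mathbb P$ is an injective strict morphism of crystals. Its image is a subcrystal of $\mathbb P$ with the integrality property: for every path $p$ in the image and every $i\in I$ the maximal value of $h^i_p$ on $[0,1]$ is an integer. Moreover, for every $n\in\mathbb Z$ the crystal $\widehat B^n_{\ell,m}$ is indecomposable (it has no non-empty subcrystal other than itself), and it is isomorphic to the subcrystal of $\mathbb P$ generated by the linear path $\tau\mapsto(m(\Lambda_1-\Lambda_0)+n\delta)\tau$. -/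

import Mathlib

namespace PathCrystal

/-! ### Crystals -/

/-- Simple roots `α_i` in a weight group `W`, and simple coroots `α_i^∨` as functionals on `W`. -/
structure RootDatum (I W : Type*) [AddCommGroup W] where
  root : I → W
  coroot : I → W →+ ℤ

/-- The operations of a crystal with underlying set `B`; the value `none` stands for the extra
element `0` of `B ⊔ {0}`. -/
structure CrystalOps (I W B : Type*) where
  e : I → B → Option B
  f : I → B → Option B
  ε : I → B → WithBot ℤ
  φ : I → B → WithBot ℤ
  wt : B → W

namespace CrystalOps

variable {I W B B₁ B₂ : Type*}

/-- The axioms of a crystal. -/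
structure IsCrystal [AddCommGroup W] (C : CrystalOps I W B) (D : RootDatum I W) : Prop where
  phi_eq : ∀ i b, C.φ i b = C.ε i b + ((D.coroot i (C.wt b) : ℤ) : WithBot ℤ)
  wt_e : ∀ i b b', C.e i b = some b' → C.wt b' = C.wt b + D.root i
  eps_e : ∀ i b b', C.e i b = some b' → C.ε i b' = C.ε i b + ((-1 : ℤ) : WithBot ℤ)
  phi_e : ∀ i b b', C.e i b = some b' → C.φ i b' = C.φ i b + ((1 : ℤ) : WithBot ℤ)
  wt_f : ∀ i b b', C.f i b = some b' → C.wt b' = C.wt b - D.root i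
  eps_f : ∀ i b b', C.f i b = some b' → C.ε i b' = C.ε i b + ((1 : ℤ) : WithBot ℤ)
  phi_f : ∀ i b b', C.f i b = some b' → C.φ i b' = C.φ i b + ((-1 : ℤ) : WithBot ℤ)
  inverse : ∀ i b b', C.e i b = some b' ↔ C.f i b' = some b
  phi_bot : ∀ i b, C.φ i b = ⊥ → C.e i b = none ∧ C.f i b = none

/-- Upper and lower normality: `ε_i(b) = max {n : e_i^n b ≠ 0}` and
`φ_i(b) = max {n : f_i^n b ≠ 0}`. -/
def IsNormal (C : CrystalOps I W B) : Prop :=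
  ∀ i b,
    (∃ n : ℕ, C.ε i b = ((n : ℤ) : WithBot ℤ) ∧
      IsGreatest {k : ℕ | (fun x : Option B => x.bind (C.e i))^[k] (some b) ≠ none} n) ∧
    (∃ n : ℕ, C.φ i b = ((n : ℤ) : WithBot ℤ) ∧
      IsGreatest {k : ℕ | (fun x : Option B => x.bind (C.f i))^[k] (some b) ≠ none} n)

/-- Morphisms of crystals `B₁ ⊔ {0} → B₂ ⊔ {0}`. -/
structure IsMorphism (C₁ : CrystalOps I W B₁) (C₂ : CrystalOps I W B₂)
    (g : Option B₁ → Option B₂) : Prop where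
  map_zero : g none = none
  eps : ∀ i b c, g (some b) = some c → C₂.ε i c = C₁.ε i b
  wt : ∀ b c, g (some b) = some c → C₂.wt c = C₁.wt b
  e : ∀ i b c, g (some b) = some c → g (C₁.e i b) ≠ none → g (C₁.e i b) = C₂.e i c
  f : ∀ i b c, g (some b) = some c → g (C₁.f i b) ≠ none → g (C₁.f i b) = C₂.f i c

/-- Strict morphisms: those that commute with all `e_i` and `f_i` (where `e_i 0 = f_i 0 = 0`). -/
structure IsStrictMorphism (C₁ : CrystalOps I W B₁) (C₂ : CrystalOps I W B₂)
    (g : Option B₁ → Option B₂) : Prop extends IsMorphism C₁ C₂ g where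
  comm_e : ∀ i x, g (x.bind (C₁.e i)) = (g x).bind (C₂.e i)
  comm_f : ∀ i x, g (x.bind (C₁.f i)) = (g x).bind (C₂.f i)

/-- Isomorphisms of crystals: bijections that are strict morphisms. -/
def Isomorphic (C₁ : CrystalOps I W B₁) (C₂ : CrystalOps I W B₂) : Prop :=
  ∃ g : B₁ ≃ B₂, IsStrictMorphism C₁ C₂ (Option.map g)

/-- A subset is a subcrystal if it is stable under all `e_i` and `f_i` (up to `0`). -/
def IsSub (C : CrystalOps I W B) (S : Set B) : Prop :=
  ∀ i, ∀ b ∈ S, ∀ b', C.e i b = some b' ∨ C.f i b = some b' → b' ∈ S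

/-- The restriction of the operations to a subcrystal. -/
def restrict (C : CrystalOps I W B) (S : Set B) (hS : C.IsSub S) : CrystalOps I W S where
  e i b := (C.e i b.1).pmap Subtype.mk fun b' h => hS i b.1 b.2 b' (Or.inl h)
  f i b := (C.f i b.1).pmap Subtype.mk fun b' h => hS i b.1 b.2 b' (Or.inr h)
  ε i b := C.ε i b.1
  φ i b := C.φ i b.1
  wt b := C.wt b.1

/-- The action of a monomial in the `e_i` (written `(true, i)`) and the `f_i` (written
`(false, i)`) on `B ⊔ {0}`; the last letter of the list acts first. -/
def act (C : CrystalOps I W B) : List (Bool × I) → Option B → Option B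
  | [], x => x
  | (true, i) :: u, x => (C.act u x).bind (C.e i)
  | (false, i) :: u, x => (C.act u x).bind (C.f i)

/-- The set `𝒜 b` of all nonzero `u b`, with `u` a monomial in the `e_i`, `f_i`. -/
def generated (C : CrystalOps I W B) (b : B) : Set B :=
  {b' | ∃ u : List (Bool × I), C.act u (some b) = some b'}

theorem isSub_generated (C : CrystalOps I W B) (b : B) : C.IsSub (C.generated b) := by
  rintro i c ⟨u, hu⟩ b' (h | h)
  · exact ⟨(true, i) :: u, by simp [act, hu, h]⟩
  · exact ⟨(false, i) :: u, by simp [act, hu, h]⟩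

/-- The subcrystal generated by `b`. -/
def generatedSub (C : CrystalOps I W B) (b : B) : CrystalOps I W (C.generated b) :=
  C.restrict (C.generated b) (C.isSub_generated b)

/-- A crystal is indecomposable if it has no non-empty subcrystal different from itself. -/
def Indecomposable (C : CrystalOps I W B) : Prop :=
  ∀ S : Set B, C.IsSub S → S.Nonempty → S = Set.univ

section Tensor

variable [AddCommGroup W] (C : CrystalOps I W B) (D : RootDatum I W) (n : ℕ)

/-- The Kashiwara function `r_k^i(b) = ε_i(b_k) - ∑_{j < k} α_i^∨(wt b_j)` on `B^{⊗ n}`. -/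
def kashiwara (i : I) (b : Fin n → B) (k : Fin n) : WithBot ℤ :=
  C.ε i (b k) +
    ((-∑ j ∈ Finset.univ.filter (fun j : Fin n => j < k), D.coroot i (C.wt (b j)) : ℤ) :
      WithBot ℤ)

/-- The places where the maximal value of the Kashiwara function is attained. -/
def maxPlaces (i : I) (b : Fin n → B) : Finset (Fin n) :=
  Finset.univ.filter fun k =>
    kashiwara C D n i b k = Finset.univ.sup (kashiwara C D n i b)

/-- The tensor power `B^{⊗ n}`; the function `b : Fin n → B` stands for
`b 0 ⊗ b 1 ⊗ ⋯ ⊗ b (n - 1)`. -/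
def tensorPower : CrystalOps I W (Fin n → B) where
  e i b :=
    if h : (maxPlaces C D n i b).Nonempty then
      (C.e i (b ((maxPlaces C D n i b).min' h))).map
        (Function.update b ((maxPlaces C D n i b).min' h))
    else none
  f i b :=
    if h : (maxPlaces C D n i b).Nonempty then
      (C.f i (b ((maxPlaces C D n i b).max' h))).map
        (Function.update b ((maxPlaces C D n i b).max' h))
    else none
  ε i b := Finset.univ.sup (kashiwara C D n i b)
  φ i b := Finset.univ.sup (kashiwara C D n i b) +
    ((D.coroot i (∑ k, C.wt (b k)) : ℤ) : WithBot ℤ)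
  wt b := ∑ k, C.wt (b k)

end Tensor

end CrystalOps

/-! ### The affine weight lattice of type `A_ℓ^{(1)}` -/

/-- The lattice `P₀ = ⨁ ℤ Λ_i`, in coordinates with respect to the `Λ_i`. -/
abbrev P₀ (ℓ : ℕ) : Type := Fin (ℓ + 1) → ℤ

/-- The lattice `P = P₀ ⊕ ℤ δ`. -/
abbrev P (ℓ : ℕ) : Type := P₀ ℓ × ℤ

/-- The rational space `ℚ P`. -/
abbrev QP (ℓ : ℕ) : Type := (Fin (ℓ + 1) → ℚ) × ℚ

/-- The inclusion of `P` in `ℚ P`. -/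
def toQP {ℓ : ℕ} (w : P ℓ) : QP ℓ := (fun i => (w.1 i : ℚ), (w.2 : ℚ))

/-- The fundamental weight `Λ_i`. -/
def Lam {ℓ : ℕ} (i : Fin (ℓ + 1)) : P₀ ℓ := Pi.single i 1

/-- The simple root `α_i = 2 Λ_i - Λ_{i-1} - Λ_{i+1} + δ_{i,0} δ`, with indices modulo `ℓ + 1`. -/
def simpleRoot {ℓ : ℕ} (i : Fin (ℓ + 1)) : P ℓ :=
  (Lam i + Lam i - Lam (i - 1) - Lam (i + 1), if i = 0 then 1 else 0)

/-- The realisation with weight lattice `P`. -/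
def affineDatum (ℓ : ℕ) : RootDatum (Fin (ℓ + 1)) (P ℓ) where
  root := simpleRoot
  coroot i := { toFun := fun w => w.1 i, map_zero' := rfl, map_add' := fun _ _ => rfl }

/-- The realisation with weight lattice `P₀ = P / ℤ δ`. -/
def finiteDatum (ℓ : ℕ) : RootDatum (Fin (ℓ + 1)) (P₀ ℓ) where
  root i := (simpleRoot i).1
  coroot i := { toFun := fun w => w i, map_zero' := rfl, map_add' := fun _ _ => rfl }

/-! ### The crystals `B_ℓ`, `B_ℓ(m)` and `B̂_{ℓ,m}` -/

/-- The finite crystal `B_ℓ = {b_0, …, b_ℓ}`; the element `b_j` is represented by `j`. -/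
def Bl (ℓ : ℕ) : CrystalOps (Fin (ℓ + 1)) (P₀ ℓ) (Fin (ℓ + 1)) where
  e i j := if i = j then some (j - 1) else none
  f i j := if i - 1 = j then some i else none
  ε i j := if i = j then ((1 : ℤ) : WithBot ℤ) else ((0 : ℤ) : WithBot ℤ)
  φ i j := if i - 1 = j then ((1 : ℤ) : WithBot ℤ) else ((0 : ℤ) : WithBot ℤ)
  wt j := Lam (j + 1) - Lam j

/-- The crystal `B_ℓ(m) = B_ℓ^{⊗ m}`. -/
def Blm (ℓ m : ℕ) : CrystalOps (Fin (ℓ + 1)) (P₀ ℓ) (Fin m → Fin (ℓ + 1)) :=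
  (Bl ℓ).tensorPower (finiteDatum ℓ) m

/-- The affine crystal `B̂_{ℓ,m}`; the pair `(b, n)` stands for `b ⊗ z^n`. -/
def BHat (ℓ m : ℕ) : CrystalOps (Fin (ℓ + 1)) (P ℓ) ((Fin m → Fin (ℓ + 1)) × ℤ) where
  e i x := ((Blm ℓ m).e i x.1).map fun b => (b, x.2 + if i = 0 then 1 else 0)
  f i x := ((Blm ℓ m).f i x.1).map fun b => (b, x.2 - if i = 0 then 1 else 0)
  ε i x := (Blm ℓ m).ε i x.1
  φ i x := (Blm ℓ m).φ i x.1
  wt x := ((Blm ℓ m).wt x.1, x.2)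

/-- The element `b_0^{⊗ m} ⊗ z^n`. -/
def bZero (ℓ m : ℕ) (n : ℤ) : (Fin m → Fin (ℓ + 1)) × ℤ := (fun _ => 0, n)

/-- The component `B̂^n_{ℓ,m}`, generated by `b_0^{⊗ m} ⊗ z^n`. -/
def BHatComponent (ℓ m : ℕ) (n : ℤ) :
    CrystalOps (Fin (ℓ + 1)) (P ℓ) ((BHat ℓ m).generated (bZero ℓ m n)) :=
  (BHat ℓ m).generatedSub (bZero ℓ m n)

/-! ### The path crystal -/

/-- The rational unit interval. -/
abbrev UnitQ : Type := Set.Icc (0 : ℚ) 1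

/-- (Continuous) piecewise-linear maps on the rational unit interval: there are finitely many
break points such that the map is affine on every closed interval without a break point in its
interior. -/
def IsPL {V : Type*} [AddCommGroup V] [Module ℚ V] (g : UnitQ → V) : Prop :=
  ∃ S : Finset UnitQ, ∀ x y : UnitQ, (∀ s ∈ S, ¬ (x < s ∧ s < y)) →
    ∃ u v : V, ∀ τ : UnitQ, x ≤ τ → τ ≤ y → g τ = u + (τ : ℚ) • v

/-- Piecewise-linear paths in `ℚ P` that start at `0` and end in `P`. The end point, as an
element of `P`, is the field `wt`. -/
structure Path (ℓ : ℕ) where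
  toFun : UnitQ → QP ℓ
  isPL : IsPL toFun
  map_zero : toFun 0 = 0
  wt : P ℓ
  map_one : toFun 1 = toQP wt

/-- `b₁ = b₂ ∘ θ` for a piecewise-linear, nondecreasing, surjective map `θ : [0,1] → [0,1]`. -/
def Reparam {ℓ : ℕ} (b₁ b₂ : Path ℓ) : Prop :=
  ∃ θ : UnitQ → UnitQ, IsPL (fun τ => (θ τ : ℚ)) ∧ Monotone θ ∧ Function.Surjective θ ∧
    ∀ τ, b₁.toFun τ = b₂.toFun (θ τ)

/-- The set `ℙ` of paths up to reparametrisation, that is, modulo the equivalence relation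
generated by `Reparam`. -/
def PathClass (ℓ : ℕ) : Type := Quot (Reparam (ℓ := ℓ))

/-- The class of a path in `ℙ`. -/
def Path.cls {ℓ : ℕ} (b : Path ℓ) : PathClass ℓ := Quot.mk Reparam b

namespace Path

variable {ℓ : ℕ}

/-- The simple reflection `s_i v = v - α_i^∨(v) α_i` on `ℚ P`. -/
def reflection (i : Fin (ℓ + 1)) (v : QP ℓ) : QP ℓ := v - v.1 i • toQP (simpleRoot i)

/-- The Littelmann function `h^i_b(τ) = -α_i^∨(b(τ))`. -/
def h (b : Path ℓ) (i : Fin (ℓ + 1)) (τ : UnitQ) : ℚ := -(b.toFun τ).1 i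

/-- `ε_i(b)`, the maximum of the integers that are values of `h^i_b`. -/
noncomputable def eps (b : Path ℓ) (i : Fin (ℓ + 1)) : ℤ := sSup {n : ℤ | ∃ τ, b.h i τ = n}

/-- `p = e^i_+(b) ≠ 0` is the first time at which `h^i_b` is `ε_i(b)`, and `q = e^i_-(b)` is the
last time before `p` at which `h^i_b` is `ε_i(b) - 1`. -/
structure IsRaising (b : Path ℓ) (i : Fin (ℓ + 1)) (q p : UnitQ) : Prop where
  least : IsLeast {τ | b.h i τ = b.eps i} p
  ne_zero : p ≠ 0
  greatest : IsGreatest {τ | τ ≤ p ∧ b.h i τ = b.eps i - 1} q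

/-- `q = f^i_+(b) ≠ 1` is the last time at which `h^i_b` is `ε_i(b)`, and `p = f^i_-(b)` is the
first time after `q` at which `h^i_b` is `ε_i(b) - 1`. -/
structure IsLowering (b : Path ℓ) (i : Fin (ℓ + 1)) (q p : UnitQ) : Prop where
  greatest : IsGreatest {τ | b.h i τ = b.eps i} q
  ne_one : q ≠ 1
  least : IsLeast {τ | q ≤ τ ∧ b.h i τ = b.eps i - 1} p

/-- The path that is `b` on `[0,q]`, the reflected path on `[q,p]`, and `b + γ` on `[p,1]`. -/
def bendFun (b : Path ℓ) (i : Fin (ℓ + 1)) (q p : UnitQ) (γ : P ℓ) (τ : UnitQ) : QP ℓ :=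
  if τ ≤ q then b.toFun τ
  else if τ ≤ p then reflection i (b.toFun τ - b.toFun q) + b.toFun q
  else b.toFun τ + toQP γ

section Bend

variable {b : Path ℓ} {i : Fin (ℓ + 1)} {q p : UnitQ} {γ : P ℓ}

theorem bendFun_left {τ : UnitQ} (hτ : τ ≤ q) : b.bendFun i q p γ τ = b.toFun τ := by
  simp [bendFun, hτ]

theorem bendFun_mid {τ : UnitQ} (h₁ : q ≤ τ) (h₂ : τ ≤ p) :
    b.bendFun i q p γ τ = reflection i (b.toFun τ - b.toFun q) + b.toFun q := by
  rcases h₁.eq_or_lt with rfl | h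
  · simp [bendFun, reflection]
  · simp [bendFun, not_le.2 h, h₂]

theorem bendFun_right (hqp : q ≤ p)
    (hγ : reflection i (b.toFun p - b.toFun q) + b.toFun q = b.toFun p + toQP γ)
    {τ : UnitQ} (hτ : p ≤ τ) : b.bendFun i q p γ τ = b.toFun τ + toQP γ := by
  rcases hτ.eq_or_lt with rfl | h
  · rw [bendFun_mid hqp le_rfl, hγ]
  · simp [bendFun, not_le.2 h, not_le.2 (hqp.trans_lt h)]

theorem isPL_bendFun (hqp : q ≤ p)
    (hγ : reflection i (b.toFun p - b.toFun q) + b.toFun q = b.toFun p + toQP γ) :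
    IsPL (b.bendFun i q p γ) := by
  obtain ⟨S, hS⟩ := b.isPL
  refine ⟨insert q (insert p S), fun x y hxy => ?_⟩
  obtain ⟨u, v, huv⟩ := hS x y fun s hs => hxy s (by simp [hs])
  have hq := hxy q (by simp)
  have hp := hxy p (by simp)
  by_cases h₁ : y ≤ q
  · exact ⟨u, v, fun τ hx hy => by rw [bendFun_left (hy.trans h₁), huv τ hx hy]⟩
  by_cases h₂ : p ≤ x
  · refine ⟨u + toQP γ, v, fun τ hx hy => ?_⟩
    rw [bendFun_right hqp hγ (h₂.trans hx), huv τ hx hy]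
    abel
  have hqx : q ≤ x := not_lt.1 fun h => hq ⟨h, not_le.1 h₁⟩
  have hyp : y ≤ p := not_lt.1 fun h => hp ⟨not_le.1 h₂, h⟩
  refine ⟨reflection i (u - b.toFun q) + b.toFun q, reflection i v, fun τ hx hy => ?_⟩
  rw [bendFun_mid (hqx.trans hx) (hy.trans hyp), huv τ hx hy]
  simp only [reflection, Prod.fst_add, Prod.fst_sub, Prod.smul_fst, Pi.add_apply, Pi.sub_apply,
    Pi.smul_apply, smul_eq_mul]
  module

/-- `bendFun` as a path; `γ` has to be chosen so that the pieces fit together. -/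
def bend (b : Path ℓ) (i : Fin (ℓ + 1)) (q p : UnitQ) (γ : P ℓ) (hqp : q ≤ p)
    (hγ : reflection i (b.toFun p - b.toFun q) + b.toFun q = b.toFun p + toQP γ) : Path ℓ where
  toFun := b.bendFun i q p γ
  isPL := isPL_bendFun hqp hγ
  map_zero := by rw [bendFun_left q.2.1, b.map_zero]
  wt := b.wt + γ
  map_one := by
    rw [bendFun_right hqp hγ p.2.2, b.map_one]
    ext <;> simp [toQP]

end Bend

theorem IsRaising.le {b : Path ℓ} {i : Fin (ℓ + 1)} {q p : UnitQ} (H : b.IsRaising i q p) :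
    q ≤ p := H.greatest.1.1

theorem IsRaising.fits {b : Path ℓ} {i : Fin (ℓ + 1)} {q p : UnitQ} (H : b.IsRaising i q p) :
    reflection i (b.toFun p - b.toFun q) + b.toFun q =
      b.toFun p + toQP (simpleRoot i) := by
  have h₁ : -(b.toFun p).1 i = b.eps i := H.least.1
  have h₂ : -(b.toFun q).1 i = b.eps i - 1 := H.greatest.1.2
  have h₃ : (b.toFun p - b.toFun q).1 i = -1 := by
    simp only [Prod.fst_sub, Pi.sub_apply]; linarith
  rw [reflection, h₃]
  module

theorem IsLowering.le {b : Path ℓ} {i : Fin (ℓ + 1)} {q p : UnitQ} (H : b.IsLowering i q p) :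
    q ≤ p := H.least.1.1

theorem IsLowering.fits {b : Path ℓ} {i : Fin (ℓ + 1)} {q p : UnitQ} (H : b.IsLowering i q p) :
    reflection i (b.toFun p - b.toFun q) + b.toFun q =
      b.toFun p + toQP (-simpleRoot i) := by
  have h₁ : -(b.toFun q).1 i = b.eps i := H.greatest.1
  have h₂ : -(b.toFun p).1 i = b.eps i - 1 := H.least.1.2
  have h₃ : (b.toFun p - b.toFun q).1 i = 1 := by
    simp only [Prod.fst_sub, Pi.sub_apply]; linarith
  have h₄ : toQP (-simpleRoot i) = -toQP (simpleRoot i) := by ext <;> simp [toQP]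
  rw [reflection, h₃, h₄]
  module

open Classical in
/-- The operator `e_i` on paths. -/
noncomputable def e (i : Fin (ℓ + 1)) (b : Path ℓ) : Option (Path ℓ) :=
  if H : ∃ t : UnitQ × UnitQ, b.IsRaising i t.1 t.2 then
    some (b.bend i H.choose.1 H.choose.2 (simpleRoot i) H.choose_spec.le H.choose_spec.fits)
  else none

open Classical in
/-- The operator `f_i` on paths. -/
noncomputable def f (i : Fin (ℓ + 1)) (b : Path ℓ) : Option (Path ℓ) :=
  if H : ∃ t : UnitQ × UnitQ, b.IsLowering i t.1 t.2 then
    some (b.bend i H.choose.1 H.choose.2 (-simpleRoot i) H.choose_spec.le H.choose_spec.fits)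
  else none

/-- The integrality property: the maximal value of `h^i_b` is an integer, for all `i`. -/
def Integral (b : Path ℓ) : Prop := ∀ i, ∃ n : ℤ, IsGreatest (Set.range (b.h i)) (n : ℚ)

end Path

/-! ### Independence of the parametrisation -/

/-- The level sets of a piecewise-linear function have a smallest and a largest element. -/
theorem IsPL.exists_extrema {g : UnitQ → ℚ} (hg : IsPL g) {c : ℚ} (hc : ∃ τ, g τ = c) :
    (∃ p, IsLeast {τ | g τ = c} p) ∧ ∃ q, IsGreatest {τ | g τ = c} q := by
  obtain ⟨S, hS⟩ := hg
  have key : ∀ n : ℕ, ∀ x y : UnitQ, (S.filter fun s => x < s ∧ s < y).card = n →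
      ({τ | g τ = c} ∩ Set.Icc x y).Nonempty →
      (∃ p, IsLeast ({τ | g τ = c} ∩ Set.Icc x y) p) ∧
        ∃ q, IsGreatest ({τ | g τ = c} ∩ Set.Icc x y) q := by
    intro n
    induction n using Nat.strong_induction_on with
    | _ n ih =>
      rintro x y hn ⟨t, ht, hxt, hty⟩
      by_cases hs : ∃ s ∈ S, x < s ∧ s < y
      · obtain ⟨s, hsS, hxs, hsy⟩ := hs
        have hl := ih (S.filter fun r => x < r ∧ r < s).card (by
          rw [← hn]
          refine Finset.card_lt_card ⟨fun r hr => ?_, fun hsub => ?_⟩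
          · rw [Finset.mem_filter] at hr ⊢
            exact ⟨hr.1, hr.2.1, hr.2.2.trans hsy⟩
          · have := hsub (Finset.mem_filter.2 ⟨hsS, hxs, hsy⟩)
            exact lt_irrefl _ (Finset.mem_filter.1 this).2.2) x s rfl
        have hr := ih (S.filter fun r => s < r ∧ r < y).card (by
          rw [← hn]
          refine Finset.card_lt_card ⟨fun r hr => ?_, fun hsub => ?_⟩
          · rw [Finset.mem_filter] at hr ⊢
            exact ⟨hr.1, hxs.trans hr.2.1, hr.2.2⟩
          · have := hsub (Finset.mem_filter.2 ⟨hsS, hxs, hsy⟩)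
            exact lt_irrefl _ (Finset.mem_filter.1 this).2.1) s y rfl
        by_cases h₁ : ({τ | g τ = c} ∩ Set.Icc x s).Nonempty
        · obtain ⟨⟨p, hp⟩, q, hq⟩ := hl h₁
          refine ⟨⟨p, ⟨hp.1.1, hp.1.2.1, hp.1.2.2.trans hsy.le⟩, fun τ hτ => ?_⟩, ?_⟩
          · rcases le_total τ s with h | h
            · exact hp.2 ⟨hτ.1, hτ.2.1, h⟩
            · exact hp.1.2.2.trans h
          · by_cases h₂ : ({τ | g τ = c} ∩ Set.Icc s y).Nonempty
            · obtain ⟨-, q', hq'⟩ := hr h₂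
              refine ⟨q', ⟨hq'.1.1, hxs.le.trans hq'.1.2.1, hq'.1.2.2⟩, fun τ hτ => ?_⟩
              rcases le_total τ s with h | h
              · exact h.trans hq'.1.2.1
              · exact hq'.2 ⟨hτ.1, h, hτ.2.2⟩
            · refine ⟨q, ⟨hq.1.1, hq.1.2.1, hq.1.2.2.trans hsy.le⟩, fun τ hτ => ?_⟩
              rcases le_total τ s with h | h
              · exact hq.2 ⟨hτ.1, hτ.2.1, h⟩
              · exact (h₂ ⟨τ, hτ.1, h, hτ.2.2⟩).elim
        · have hst : s ≤ t := not_lt.1 fun h => h₁ ⟨t, ht, hxt, h.le⟩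
          obtain ⟨⟨p, hp⟩, q, hq⟩ := hr ⟨t, ht, hst, hty⟩
          have hmem : ∀ τ ∈ ({τ | g τ = c} ∩ Set.Icc x y), s ≤ τ := fun τ hτ =>
            not_lt.1 fun h => h₁ ⟨τ, hτ.1, hτ.2.1, h.le⟩
          exact ⟨⟨p, ⟨hp.1.1, hxs.le.trans hp.1.2.1, hp.1.2.2⟩,
              fun τ hτ => hp.2 ⟨hτ.1, hmem τ hτ, hτ.2.2⟩⟩,
            q, ⟨hq.1.1, hxs.le.trans hq.1.2.1, hq.1.2.2⟩,
              fun τ hτ => hq.2 ⟨hτ.1, hmem τ hτ, hτ.2.2⟩⟩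
      · push Not at hs
        obtain ⟨u, v, huv⟩ := hS x y fun s hsS h => not_lt.2 (hs s hsS h.1) h.2
        have hxy : x ≤ y := hxt.trans hty
        by_cases hv : v = 0
        · subst hv
          have hc' : ∀ τ, x ≤ τ → τ ≤ y → g τ = c := fun τ h₁ h₂ => by
            rw [← show g t = c from ht, huv τ h₁ h₂, huv t hxt hty]; simp
          exact ⟨⟨x, ⟨hc' x le_rfl hxy, le_rfl, hxy⟩, fun τ hτ => hτ.2.1⟩,
            y, ⟨hc' y hxy le_rfl, hxy, le_rfl⟩, fun τ hτ => hτ.2.2⟩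
        · have huniq : ∀ τ ∈ ({τ | g τ = c} ∩ Set.Icc x y), τ = t := by
            rintro τ ⟨h, h₁, h₂⟩
            have h₃ : u + (τ : ℚ) • v = u + (t : ℚ) • v := by
              rw [← huv τ h₁ h₂, ← huv t hxt hty, show g τ = c from h, show g t = c from ht]
            have h₄ : (τ : ℚ) * v = (t : ℚ) * v := by simpa using h₃
            exact Subtype.ext (mul_right_cancel₀ hv h₄)
          exact ⟨⟨t, ⟨ht, hxt, hty⟩, fun τ hτ => (huniq τ hτ).ge⟩,
            t, ⟨ht, hxt, hty⟩, fun τ hτ => (huniq τ hτ).le⟩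
  obtain ⟨τ, hτ⟩ := hc
  have := key _ 0 1 rfl ⟨τ, hτ, τ.2.1, τ.2.2⟩
  have huniv : Set.Icc (0 : UnitQ) 1 = Set.univ := Set.eq_univ_of_forall fun τ => ⟨τ.2.1, τ.2.2⟩
  simpa only [huniv, Set.inter_univ] using this

namespace Path

variable {ℓ : ℕ}

theorem toQP_injective : Function.Injective (toQP (ℓ := ℓ)) := by
  intro w w' h
  have h₁ := congrArg Prod.fst h
  have h₂ := congrArg Prod.snd h
  refine Prod.ext (funext fun i => ?_) ?_
  · have h₃ : (w.1 i : ℚ) = (w'.1 i : ℚ) := congrFun h₁ i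
    exact_mod_cast h₃
  · simp only [toQP] at h₂
    exact_mod_cast h₂

section Invariance

variable {b₁ b₂ : Path ℓ} {θ : UnitQ → UnitQ} {i : Fin (ℓ + 1)}

theorem h_comp (hb : ∀ τ, b₁.toFun τ = b₂.toFun (θ τ)) (τ : UnitQ) :
    b₁.h i τ = b₂.h i (θ τ) := by rw [h, h, hb]

theorem range_h (hs : Function.Surjective θ) (hb : ∀ τ, b₁.toFun τ = b₂.toFun (θ τ)) :
    Set.range (b₁.h i) = Set.range (b₂.h i) := by
  have : b₁.h i = b₂.h i ∘ θ := funext (h_comp hb)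
  rw [this, hs.range_comp]

theorem eps_comp (hs : Function.Surjective θ) (hb : ∀ τ, b₁.toFun τ = b₂.toFun (θ τ)) :
    b₁.eps i = b₂.eps i := by
  have : ∀ n : ℤ, (∃ τ, b₁.h i τ = n) ↔ ∃ τ, b₂.h i τ = n := fun n =>
    Set.ext_iff.1 (range_h (i := i) hs hb) n
  simp only [eps, this]

theorem theta_zero (hm : Monotone θ) (hs : Function.Surjective θ) : θ 0 = 0 := by
  obtain ⟨τ, hτ⟩ := hs 0
  have h : θ 0 ≤ θ τ := hm τ.2.1
  exact le_antisymm (h.trans_eq hτ) (θ 0).2.1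

theorem theta_one (hm : Monotone θ) (hs : Function.Surjective θ) : θ 1 = 1 := by
  obtain ⟨τ, hτ⟩ := hs 1
  have h : θ τ ≤ θ 1 := hm τ.2.2
  exact le_antisymm (θ 1).2.2 (hτ.symm.trans_le h)

theorem wt_comp (hm : Monotone θ) (hs : Function.Surjective θ)
    (hb : ∀ τ, b₁.toFun τ = b₂.toFun (θ τ)) : b₁.wt = b₂.wt := by
  apply toQP_injective
  rw [← b₁.map_one, ← b₂.map_one, hb, theta_one hm hs]

theorem fibre_extrema (hpl : IsPL (fun τ => (θ τ : ℚ))) (hs : Function.Surjective θ) (x : UnitQ) :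
    (∃ p, IsLeast {τ | θ τ = x} p) ∧ ∃ q, IsGreatest {τ | θ τ = x} q := by
  obtain ⟨τ, hτ⟩ := hs x
  have := hpl.exists_extrema (c := (x : ℚ)) ⟨τ, by rw [hτ]⟩
  simpa only [Subtype.ext_iff] using this

theorem IsRaising.map (hm : Monotone θ) (hs : Function.Surjective θ)
    (hb : ∀ τ, b₁.toFun τ = b₂.toFun (θ τ)) {q p : UnitQ} (H : b₁.IsRaising i q p) :
    b₂.IsRaising i (θ q) (θ p) := by
  have hε := eps_comp (i := i) hs hb
  have hp : b₁.h i p = b₁.eps i := H.least.1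
  refine ⟨⟨?_, ?_⟩, ?_, ⟨⟨hm H.le, ?_⟩, ?_⟩⟩
  · change b₂.h i (θ p) = _
    rw [← h_comp hb, ← hε, hp]
  · intro σ hσ
    obtain ⟨τ, rfl⟩ := hs σ
    refine hm (H.least.2 ?_)
    change b₁.h i τ = _
    rw [h_comp hb, hε]
    exact hσ
  · intro h0
    refine H.ne_zero (le_antisymm (H.least.2 ?_) p.2.1)
    change b₁.h i 0 = _
    rw [h_comp hb, theta_zero hm hs, ← h0, ← h_comp hb, hp]
  · rw [← h_comp hb, ← hε]
    exact H.greatest.1.2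
  · rintro σ ⟨hσ₁, hσ₂⟩
    obtain ⟨τ, rfl⟩ := hs σ
    rw [← h_comp hb, ← hε] at hσ₂
    rcases le_total τ p with h | h
    · exact hm (H.greatest.2 ⟨h, hσ₂⟩)
    · have h₁ : θ τ = θ p := le_antisymm hσ₁ (hm h)
      have h₂ : b₁.h i τ = b₁.h i p := by rw [h_comp hb, h_comp hb, h₁]
      rw [hσ₂, hp] at h₂
      linarith

theorem IsRaising.comap (hpl : IsPL (fun τ => (θ τ : ℚ))) (hm : Monotone θ)
    (hs : Function.Surjective θ) (hb : ∀ τ, b₁.toFun τ = b₂.toFun (θ τ)) {q p : UnitQ}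
    (H : b₂.IsRaising i q p) : ∃ q' p', b₁.IsRaising i q' p' := by
  have hε := eps_comp (i := i) hs hb
  obtain ⟨p', hp', hp'l⟩ := (fibre_extrema hpl hs p).1
  obtain ⟨q', hq', hq'g⟩ := (fibre_extrema hpl hs q).2
  have hp : b₂.h i p = b₂.eps i := H.least.1
  have hq : b₂.h i q = b₂.eps i - 1 := H.greatest.1.2
  have hp'' : θ p' = p := hp'
  have hq'' : θ q' = q := hq'
  have hqp : q < p := lt_of_le_of_ne H.le fun h => by rw [h, hp] at hq; linarith
  refine ⟨q', p', ⟨?_, ?_⟩, ?_, ⟨⟨?_, ?_⟩, ?_⟩⟩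
  · change b₁.h i p' = _
    rw [h_comp hb, hp'', hε, hp]
  · intro τ hτ
    have hτ' : b₁.h i τ = b₁.eps i := hτ
    rw [h_comp hb, hε] at hτ'
    rcases le_total p' τ with h | h
    · exact h
    · exact hp'l (le_antisymm (hp'' ▸ hm h) (H.least.2 hτ'))
  · rintro rfl
    exact H.ne_zero (hp''.symm.trans (theta_zero hm hs))
  · exact not_lt.1 fun h => not_lt.2 (hm h.le) (by rwa [hp'', hq''])
  · rw [h_comp hb, hq'', hε, hq]
  · rintro τ ⟨hτ₁, hτ₂⟩
    rw [h_comp hb, hε] at hτ₂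
    have h₁ : θ τ ≤ q := H.greatest.2 ⟨hp'' ▸ hm hτ₁, hτ₂⟩
    rcases le_total τ q' with h | h
    · exact h
    · exact hq'g (le_antisymm h₁ (hq'' ▸ hm h))

theorem IsLowering.map (hm : Monotone θ) (hs : Function.Surjective θ)
    (hb : ∀ τ, b₁.toFun τ = b₂.toFun (θ τ)) {q p : UnitQ} (H : b₁.IsLowering i q p) :
    b₂.IsLowering i (θ q) (θ p) := by
  have hε := eps_comp (i := i) hs hb
  have hq : b₁.h i q = b₁.eps i := H.greatest.1
  refine ⟨⟨?_, ?_⟩, ?_, ⟨⟨hm H.le, ?_⟩, ?_⟩⟩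
  · change b₂.h i (θ q) = _
    rw [← h_comp hb, ← hε, hq]
  · intro σ hσ
    obtain ⟨τ, rfl⟩ := hs σ
    refine hm (H.greatest.2 ?_)
    change b₁.h i τ = _
    rw [h_comp hb, hε]
    exact hσ
  · intro h1
    refine H.ne_one (le_antisymm q.2.2 (H.greatest.2 ?_))
    change b₁.h i 1 = _
    rw [h_comp hb, theta_one hm hs, ← h1, ← h_comp hb, hq]
  · rw [← h_comp hb, ← hε]
    exact H.least.1.2
  · rintro σ ⟨hσ₁, hσ₂⟩
    obtain ⟨τ, rfl⟩ := hs σ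
    rw [← h_comp hb, ← hε] at hσ₂
    rcases le_total q τ with h | h
    · exact hm (H.least.2 ⟨h, hσ₂⟩)
    · have h₁ : θ τ = θ q := le_antisymm (hm h) hσ₁
      have h₂ : b₁.h i τ = b₁.h i q := by rw [h_comp hb, h_comp hb, h₁]
      rw [hσ₂, hq] at h₂
      linarith

theorem IsLowering.comap (hpl : IsPL (fun τ => (θ τ : ℚ))) (hm : Monotone θ)
    (hs : Function.Surjective θ) (hb : ∀ τ, b₁.toFun τ = b₂.toFun (θ τ)) {q p : UnitQ}
    (H : b₂.IsLowering i q p) : ∃ q' p', b₁.IsLowering i q' p' := by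
  have hε := eps_comp (i := i) hs hb
  obtain ⟨p', hp', hp'l⟩ := (fibre_extrema hpl hs p).1
  obtain ⟨q', hq', hq'g⟩ := (fibre_extrema hpl hs q).2
  have hq : b₂.h i q = b₂.eps i := H.greatest.1
  have hp : b₂.h i p = b₂.eps i - 1 := H.least.1.2
  have hp'' : θ p' = p := hp'
  have hq'' : θ q' = q := hq'
  have hqp : q < p := lt_of_le_of_ne H.le fun h => by rw [← h, hq] at hp; linarith
  refine ⟨q', p', ⟨?_, ?_⟩, ?_, ⟨⟨?_, ?_⟩, ?_⟩⟩
  · change b₁.h i q' = _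
    rw [h_comp hb, hq'', hε, hq]
  · intro τ hτ
    have hτ' : b₁.h i τ = b₁.eps i := hτ
    rw [h_comp hb, hε] at hτ'
    rcases le_total τ q' with h | h
    · exact h
    · exact hq'g (le_antisymm (H.greatest.2 hτ') (hq'' ▸ hm h))
  · rintro rfl
    exact H.ne_one (hq''.symm.trans (theta_one hm hs))
  · exact not_lt.1 fun h => not_lt.2 (hm h.le) (by rwa [hp'', hq''])
  · rw [h_comp hb, hp'', hε, hp]
  · rintro τ ⟨hτ₁, hτ₂⟩
    rw [h_comp hb, hε] at hτ₂
    have h₁ : p ≤ θ τ := H.least.2 ⟨hq'' ▸ hm hτ₁, hτ₂⟩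
    rcases le_total p' τ with h | h
    · exact h
    · exact hp'l (le_antisymm (hp'' ▸ hm h) h₁)

theorem reparam_bend (hpl : IsPL (fun τ => (θ τ : ℚ))) (hm : Monotone θ)
    (hs : Function.Surjective θ) (hb : ∀ τ, b₁.toFun τ = b₂.toFun (θ τ)) {q p q' p' : UnitQ}
    {γ : P ℓ} (hq : θ q = q') (hp : θ p = p') (h₁ h₂ h₃ h₄) :
    Reparam (b₁.bend i q p γ h₁ h₂) (b₂.bend i q' p' γ h₃ h₄) := by
  subst hq hp
  refine ⟨θ, hpl, hm, hs, fun τ => ?_⟩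
  change b₁.bendFun i q p γ τ = b₂.bendFun i (θ q) (θ p) γ (θ τ)
  rcases le_total τ q with h | h
  · rw [bendFun_left h, bendFun_left (hm h), hb]
  rcases le_total τ p with h' | h'
  · rw [bendFun_mid h h', bendFun_mid (hm h) (hm h'), hb, hb]
  · rw [bendFun_right h₁ h₂ h', bendFun_right h₃ h₄ (hm h'), hb]

theorem IsRaising.unique {b : Path ℓ} {q p q' p' : UnitQ} (H : b.IsRaising i q p)
    (H' : b.IsRaising i q' p') : q = q' ∧ p = p' := by
  have hp : p = p' := H.least.unique H'.least
  subst hp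
  exact ⟨H.greatest.unique H'.greatest, rfl⟩

theorem IsLowering.unique {b : Path ℓ} {q p q' p' : UnitQ} (H : b.IsLowering i q p)
    (H' : b.IsLowering i q' p') : q = q' ∧ p = p' := by
  have hq : q = q' := H.greatest.unique H'.greatest
  subst hq
  exact ⟨rfl, H.least.unique H'.least⟩

end Invariance

theorem e_reparam (i : Fin (ℓ + 1)) (b₁ b₂ : Path ℓ) (hr : Reparam b₁ b₂) :
    (b₁.e i).map cls = (b₂.e i).map cls := by
  obtain ⟨θ, hpl, hm, hs, hb⟩ := hr
  by_cases H : ∃ t : UnitQ × UnitQ, b₁.IsRaising i t.1 t.2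
  · have H₂ : ∃ t : UnitQ × UnitQ, b₂.IsRaising i t.1 t.2 :=
      ⟨(θ H.choose.1, θ H.choose.2), H.choose_spec.map hm hs hb⟩
    obtain ⟨h₁, h₂⟩ := (H.choose_spec.map hm hs hb).unique H₂.choose_spec
    rw [e, e, dif_pos H, dif_pos H₂, Option.map_some, Option.map_some]
    exact congrArg some (Quot.sound (reparam_bend hpl hm hs hb h₁ h₂ _ _ _ _))
  · have H₂ : ¬ ∃ t : UnitQ × UnitQ, b₂.IsRaising i t.1 t.2 := by
      rintro ⟨t, ht⟩
      obtain ⟨q', p', h'⟩ := ht.comap hpl hm hs hb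
      exact H ⟨(q', p'), h'⟩
    rw [e, e, dif_neg H, dif_neg H₂, Option.map_none]

theorem f_reparam (i : Fin (ℓ + 1)) (b₁ b₂ : Path ℓ) (hr : Reparam b₁ b₂) :
    (b₁.f i).map cls = (b₂.f i).map cls := by
  obtain ⟨θ, hpl, hm, hs, hb⟩ := hr
  by_cases H : ∃ t : UnitQ × UnitQ, b₁.IsLowering i t.1 t.2
  · have H₂ : ∃ t : UnitQ × UnitQ, b₂.IsLowering i t.1 t.2 :=
      ⟨(θ H.choose.1, θ H.choose.2), H.choose_spec.map hm hs hb⟩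
    obtain ⟨h₁, h₂⟩ := (H.choose_spec.map hm hs hb).unique H₂.choose_spec
    rw [f, f, dif_pos H, dif_pos H₂, Option.map_some, Option.map_some]
    exact congrArg some (Quot.sound (reparam_bend hpl hm hs hb h₁ h₂ _ _ _ _))
  · have H₂ : ¬ ∃ t : UnitQ × UnitQ, b₂.IsLowering i t.1 t.2 := by
      rintro ⟨t, ht⟩
      obtain ⟨q', p', h'⟩ := ht.comap hpl hm hs hb
      exact H ⟨(q', p'), h'⟩
    rw [f, f, dif_neg H, dif_neg H₂, Option.map_none]

theorem integral_reparam (b₁ b₂ : Path ℓ) (hr : Reparam b₁ b₂) : b₁.Integral = b₂.Integral := by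
  obtain ⟨θ, -, -, hs, hb⟩ := hr
  simp only [Integral, range_h hs hb]

end Path

/-- Littelmann's path crystal `ℙ`. -/
noncomputable def pathCrystal (ℓ : ℕ) : CrystalOps (Fin (ℓ + 1)) (P ℓ) (PathClass ℓ) where
  e i := Quot.lift (fun b => (b.e i).map Path.cls) (Path.e_reparam i)
  f i := Quot.lift (fun b => (b.f i).map Path.cls) (Path.f_reparam i)
  ε i := Quot.lift (fun b => ((b.eps i : ℤ) : WithBot ℤ)) fun _ _ ⟨_, _, _, hs, hb⟩ => by
    rw [Path.eps_comp hs hb]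
  φ i := Quot.lift (fun b => ((b.eps i + b.wt.1 i : ℤ) : WithBot ℤ))
    fun _ _ ⟨_, _, hm, hs, hb⟩ => by rw [Path.eps_comp hs hb, Path.wt_comp hm hs hb]
  wt := Quot.lift Path.wt fun _ _ ⟨_, _, hm, hs, hb⟩ => Path.wt_comp hm hs hb

/-- The integrality property of a path up to reparametrisation. -/
def PathClass.Integral {ℓ : ℕ} : PathClass ℓ → Prop := Quot.lift Path.Integral Path.integral_reparam

/-! ### Broken lines -/

/-- The map that is `λ_s + (r τ - s) (λ_{s+1} - λ_s)` on `[s/r, (s+1)/r]`, for `0 ≤ s < r`. -/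
def brokenFun {ℓ : ℕ} (r : ℕ) (lam : ℕ → QP ℓ) (τ : UnitQ) : QP ℓ :=
  lam ⌊(r : ℚ) * τ⌋₊ +
    ((r : ℚ) * τ - ⌊(r : ℚ) * τ⌋₊) • (lam (⌊(r : ℚ) * τ⌋₊ + 1) - lam ⌊(r : ℚ) * τ⌋₊)

theorem brokenFun_eq {ℓ : ℕ} {r : ℕ} (lam : ℕ → QP ℓ) {τ : UnitQ} {s : ℕ}
    (h₁ : (s : ℚ) ≤ r * τ) (h₂ : (r : ℚ) * τ ≤ s + 1) :
    brokenFun r lam τ = lam s + ((r : ℚ) * τ - s) • (lam (s + 1) - lam s) := by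
  rcases h₂.eq_or_lt with h | h
  · have hf : ⌊(r : ℚ) * τ⌋₊ = s + 1 := by
      rw [h]; exact_mod_cast Nat.floor_natCast (R := ℚ) (s + 1)
    rw [brokenFun, hf, h]
    push_cast
    module
  · have hf : ⌊(r : ℚ) * τ⌋₊ = s := (Nat.floor_eq_iff ((Nat.cast_nonneg s).trans h₁)).2 ⟨h₁, h⟩
    rw [brokenFun, hf]

theorem isPL_brokenFun {ℓ : ℕ} (r : ℕ) (lam : ℕ → QP ℓ) : IsPL (brokenFun r lam) := by
  classical
  refine ⟨(Finset.range (r + 1)).image fun s : ℕ =>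
    if h : (s : ℚ) / r ∈ Set.Icc (0 : ℚ) 1 then (⟨(s : ℚ) / r, h⟩ : UnitQ) else 0,
    fun x y hxy => ?_⟩
  have hx0 : (0 : ℚ) ≤ r * x := mul_nonneg (Nat.cast_nonneg r) x.2.1
  set s : ℕ := ⌊(r : ℚ) * x⌋₊ with hs
  have hsx : (s : ℚ) ≤ r * x := Nat.floor_le hx0
  have hxs : (r : ℚ) * x < s + 1 := Nat.lt_floor_add_one _
  have hys : (r : ℚ) * y ≤ s + 1 := by
    by_contra! hlt
    have hry : (r : ℚ) * y ≤ r := mul_le_of_le_one_right (Nat.cast_nonneg r) y.2.2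
    have hsr : s + 1 < r := by exact_mod_cast hlt.trans_le hry
    have hr : (0 : ℚ) < r := by exact_mod_cast (Nat.zero_le _).trans_lt hsr
    have hmem : ((s + 1 : ℕ) : ℚ) / r ∈ Set.Icc (0 : ℚ) 1 :=
      ⟨by positivity, (div_le_one hr).2 (by exact_mod_cast hsr.le)⟩
    refine hxy ⟨((s + 1 : ℕ) : ℚ) / r, hmem⟩
      (Finset.mem_image.2 ⟨s + 1, Finset.mem_range.2 (by omega), dif_pos hmem⟩) ⟨?_, ?_⟩
    · rw [← Subtype.coe_lt_coe, lt_div_iff₀ hr]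
      push_cast
      linarith
    · rw [← Subtype.coe_lt_coe, div_lt_iff₀ hr]
      push_cast
      linarith
  refine ⟨lam s - (s : ℚ) • (lam (s + 1) - lam s), (r : ℚ) • (lam (s + 1) - lam s),
    fun τ hx hy => ?_⟩
  have h₁ : (r : ℚ) * x ≤ r * τ := mul_le_mul_of_nonneg_left hx (Nat.cast_nonneg r)
  have h₂ : (r : ℚ) * τ ≤ r * y := mul_le_mul_of_nonneg_left hy (Nat.cast_nonneg r)
  rw [brokenFun_eq lam (hsx.trans h₁) (h₂.trans hys)]
  module

/-- The path `p_λ` for `λ = (λ_0, …, λ_r)` with `λ_0 = 0` and `λ_r = w ∈ P`. -/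
def brokenPath {ℓ : ℕ} (r : ℕ) (lam : ℕ → QP ℓ) (w : P ℓ) (h₀ : lam 0 = 0)
    (hr : lam r = toQP w) : Path ℓ where
  toFun := brokenFun r lam
  isPL := isPL_brokenFun r lam
  map_zero := by
    rw [brokenFun_eq (s := 0) lam (by simp) (by simp)]
    simp [h₀]
  wt := w
  map_one := by
    rw [brokenFun_eq (s := r) lam (by simp) (by simp)]
    simp [hr]

/-- The linear path `τ ↦ τ w`. -/
def linearPath {ℓ : ℕ} (w : P ℓ) : Path ℓ where
  toFun τ := (τ : ℚ) • toQP w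
  isPL := ⟨∅, fun _ _ _ => ⟨0, toQP w, fun _ _ _ => (zero_add _).symm⟩⟩
  map_zero := by simp
  wt := w
  map_one := by simp

/-! ### The map `ψ` -/

section Psi

variable {ℓ m : ℕ} (b : Fin m → Fin (ℓ + 1))

/-- For `b = b_{i_m} ⊗ ⋯ ⊗ b_{i_1}` and `1 ≤ t ≤ m`, this is `i_t`, so that the leftmost factor
has the index `t = m`. -/
def letter (t : ℕ) : ℕ := if h : m - t < m then (b ⟨m - t, h⟩ : ℕ) else 0

/-- `desc(b) = {r : 1 ≤ r < m, i_r > i_{r+1}}`. -/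
def desc : Finset ℕ := (Finset.Ico 1 m).filter fun r => letter b (r + 1) < letter b r

/-- The set `{n_0 < ⋯ < n_k}`, obtained from `desc(b)` by adding `n_0 = 0` and `n_k = m`. -/
def majSet : Finset ℕ := insert 0 (insert m (desc b))

/-- `k = # desc(b) + 1`. -/
def blocks : ℕ := (desc b).card + 1

/-- `n_r`, for `0 ≤ r ≤ k`. -/
noncomputable def cut (r : ℕ) : ℕ := Nat.nth (· ∈ majSet b) r

/-- `N(b) = ∑_{r=1}^k r (n_r - n_{r-1})`. -/
noncomputable def bigN : ℤ :=
  ∑ r ∈ Finset.Icc 1 (blocks b), (r : ℤ) * ((cut b r : ℤ) - (cut b (r - 1) : ℤ))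

/-- `ρ_s(b)`, the unique `r` with `1 ≤ r ≤ k` and `n_{r-1} < m - s + 1 ≤ n_r`; here
`1 ≤ s ≤ m`. -/
noncomputable def rho (s : ℕ) : ℕ :=
  sInf {r | 1 ≤ r ∧ r ≤ blocks b ∧ cut b (r - 1) < m - s + 1 ∧ m - s + 1 ≤ cut b r}

/-- `κ_s(b ⊗ z^n)`, defined by recursion on `s`. -/
noncomputable def kappa (n : ℤ) : ℕ → ℚ
  | 0 => 0
  | s + 1 => kappa n s - ((rho b (s + 1) : ℚ) - 1) + ((bigN b : ℚ) + n - m) / m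

/-- `λ_s = ∑_{t=m-s+1}^m wt b_{i_t} + κ_s(b ⊗ z^n) δ`; the sum runs over the first `s` factors
from the left. -/
noncomputable def lamSeq (n : ℤ) (s : ℕ) : QP ℓ :=
  toQP (∑ k ∈ Finset.univ.filter (fun k : Fin m => (k : ℕ) < s), (Bl ℓ).wt (b k), 0) +
    (0, kappa b n s)

/-! The end point of the broken line is `wt b + n δ`, so that it is in `P`. -/

theorem mem_desc {r : ℕ} (hr : r ∈ desc b) : 0 < r ∧ r < m := by
  have := (Finset.mem_filter.1 hr).1
  rw [Finset.mem_Ico] at this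
  omega

theorem card_majSet (hm : 0 < m) : (majSet b).card = blocks b + 1 := by
  rw [majSet, Finset.card_insert_of_notMem, Finset.card_insert_of_notMem, blocks]
  · exact fun h => lt_irrefl _ (mem_desc b h).2
  · rw [Finset.mem_insert]
    rintro (h | h)
    · omega
    · exact lt_irrefl _ (mem_desc b h).1

theorem cut_lt_cut (hm : 0 < m) {r s : ℕ} (hrs : r < s) (hs : s ≤ blocks b) :
    cut b r < cut b s := by
  refine Nat.nth_lt_nth' hrs fun hf => ?_
  have hc : hf.toFinset = majSet b := by ext x; simp
  rw [hc, card_majSet b hm]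
  omega

theorem cut_zero : cut b 0 = 0 := Nat.nth_zero_of_zero (by simp [majSet])

theorem cut_blocks (hm : 0 < m) : cut b (blocks b) = m := by
  classical
  have hcount : Nat.count (· ∈ majSet b) m = blocks b := by
    have : (Finset.range m).filter (· ∈ majSet b) = insert 0 (desc b) := by
      ext x
      simp only [majSet, Finset.mem_filter, Finset.mem_range, Finset.mem_insert]
      constructor
      · rintro ⟨h, h' | h' | h'⟩
        · exact Or.inl h'
        · omega
        · exact Or.inr h'
      · rintro (h | h)
        · exact ⟨by omega, Or.inl h⟩
        · exact ⟨(mem_desc b h).2, Or.inr (Or.inr h)⟩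
    rw [Nat.count_eq_card_filter_range, this, Finset.card_insert_of_notMem, blocks]
    exact fun h => lt_irrefl _ (mem_desc b h).1
  rw [cut, ← hcount]
  exact Nat.nth_count (p := (· ∈ majSet b)) (by simp [majSet])

theorem rho_eq (hm : 0 < m) {s r : ℕ} (h₁ : 1 ≤ r) (h₂ : r ≤ blocks b)
    (h₃ : cut b (r - 1) < m - s + 1) (h₄ : m - s + 1 ≤ cut b r) : rho b s = r := by
  have hmono : ∀ {x y : ℕ}, x ≤ y → y ≤ blocks b → cut b x ≤ cut b y := fun {x y} h h' =>
    h.eq_or_lt.elim (fun e => e ▸ le_rfl) fun h => (cut_lt_cut b hm h h').le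
  have : {r | 1 ≤ r ∧ r ≤ blocks b ∧ cut b (r - 1) < m - s + 1 ∧ m - s + 1 ≤ cut b r} = {r} := by
    ext x
    simp only [Set.mem_ofPred_eq, Set.mem_singleton_iff]
    constructor
    · rintro ⟨k₁, k₂, k₃, k₄⟩
      rcases lt_trichotomy x r with h | h | h
      · have := hmono (show x ≤ r - 1 by omega) (by omega)
        omega
      · exact h
      · have := hmono (show r ≤ x - 1 by omega) (by omega)
        omega
    · rintro rfl
      exact ⟨h₁, h₂, h₃, h₄⟩
  rw [rho, this, csInf_singleton]

theorem sum_rho (hm : 0 < m) :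
    ∑ s ∈ Finset.range m, (rho b (s + 1) : ℤ) = bigN b := by
  have key : ∀ j ≤ blocks b, ∑ t ∈ Finset.range (cut b j), (rho b (m - t) : ℤ) =
      ∑ r ∈ Finset.Icc 1 j, (r : ℤ) * ((cut b r : ℤ) - (cut b (r - 1) : ℤ)) := by
    intro j
    induction j with
    | zero => intro _; simp [cut_zero]
    | succ j ih =>
      intro hj
      have hlt : cut b j < cut b (j + 1) := cut_lt_cut b hm (Nat.lt_succ_self j) hj
      have hle : cut b (j + 1) ≤ m := by
        rcases hj.eq_or_lt with h | h
        · rw [h, cut_blocks b hm]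
        · exact (cut_lt_cut b hm h le_rfl).le.trans (cut_blocks b hm).le
      rw [Finset.sum_Icc_succ_top (by omega), ← ih (by omega),
        ← Finset.sum_range_add_sum_Ico _ hlt.le]
      congr 1
      rw [Finset.sum_congr rfl (g := fun _ => ((j + 1 : ℕ) : ℤ)) fun t ht => ?_]
      · rw [Finset.sum_const, Nat.card_Ico, nsmul_eq_mul, Nat.cast_sub hlt.le, mul_comm]
        simp
      · rw [Finset.mem_Ico] at ht
        rw [rho_eq b hm (r := j + 1) (by omega) hj]
        · simp only [Nat.add_sub_cancel]; omega
        · omega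
  have h := key (blocks b) le_rfl
  rw [cut_blocks b hm] at h
  rw [bigN, ← h, ← Finset.sum_range_reflect]
  refine Finset.sum_congr rfl fun t ht => ?_
  rw [Finset.mem_range] at ht
  congr 2
  omega

theorem kappa_eq (n : ℤ) (s : ℕ) : kappa b n s =
    s * (1 + ((bigN b : ℚ) + n - m) / m) - ∑ t ∈ Finset.range s, (rho b (t + 1) : ℚ) := by
  induction s with
  | zero => simp [kappa]
  | succ s ih =>
    rw [kappa, ih, Finset.sum_range_succ]
    push_cast
    ring

theorem kappa_last (hm : 0 < m) (n : ℤ) : kappa b n m = n := by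
  have h : ∑ s ∈ Finset.range m, (rho b (s + 1) : ℚ) = bigN b := by exact_mod_cast sum_rho b hm
  have hm' : (m : ℚ) ≠ 0 := by exact_mod_cast hm.ne'
  rw [kappa_eq, h]
  field_simp
  ring

theorem lamSeq_zero (n : ℤ) : lamSeq b n 0 = 0 := by
  ext <;> simp [lamSeq, toQP, kappa]

theorem lamSeq_last (hm : 0 < m) (n : ℤ) : lamSeq b n m = toQP ((BHat ℓ m).wt (b, n)) := by
  ext <;> simp [lamSeq, toQP, kappa_last b hm, BHat, Blm, CrystalOps.tensorPower]

end Psi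

/-- The map `ψ : B̂_{ℓ,m} → ℙ`, `b ⊗ z^n ↦ p_λ`. -/
noncomputable def psi (ℓ m : ℕ) [NeZero m] (x : (Fin m → Fin (ℓ + 1)) × ℤ) : PathClass ℓ :=
  (brokenPath m (lamSeq x.1 x.2) ((BHat ℓ m).wt x) (lamSeq_zero x.1 x.2)
    (lamSeq_last x.1 (Nat.pos_of_ne_zero (NeZero.ne m)) x.2)).cls

end PathCrystal

/-!
The crystal axioms and normality are verified for the path crystal and then pulled back along `ψ`;
no theory of tensor products of crystals is needed.

*The path crystal.* Piecewise-linear functions over `ℚ` are bounded and satisfy the intermediate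
value theorem, because they are affine on finitely many intervals (`IsPL.induction_on`). Hence
`e_i p` is defined exactly if `ε_i(p) > 0`, and `f_i p` exactly if `φ_i(p) > 0`. On the reflected
segment `h^i` takes values between `ε_i(p) - 1` and `ε_i(p)`, so that `f_i` bends `e_i p` at the
very places where `e_i` bent `p` (`Path.IsRaising.isLowering_bend`), and vice versa. So `e_i` and
`f_i` are inverse to each other already on paths, not only on their classes.

*Compatibility of `ψ` with the operators.* The values of `h^i` at the vertices of `ψ(b ⊗ z^n)` are
integers (`height`) which change by at most one along each segment, and the Kashiwara function
`r_k^i(b)` is the larger of the values at the two ends of the `k`-th segment (`kashiwara_eq`). So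
the tensor product rule and Littelmann's rule select the same segment. Reflecting it adds `α_i` to
the segment of a letter `i` and turns it into the segment of the letter `i - 1`. It remains to
compare the coefficients of `δ`. The number `ρ_s(b) - 1` counts the ascents of `b`, read from the
left, from the place of the `s`-th letter on (`rho_succ`). If `i ≠ 0`, then the chosen letter can be
changed without changing the set of ascents; if `i = 0`, then the ascent to the
right of the letter is lost and one to its left is gained (as far as it has neighbours), and
together with the passage from `n` to `n + 1` this raises the `δ`-coefficient of the bent segment, and of no other segment, by one
(`kappa_update`).

*Injectivity.* Reparametrisation preserves the sequences of points that a path visits in order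
(`Path.visits_iff_of_reparam`). A path `ψ(b ⊗ z^n)` has integral coordinates with respect to the
`Λ_i` only at its `m + 1` vertices, so its class determines the vertices, and these determine
`b ⊗ z^n`.

*Components.* As `e_i` and `f_i` are inverse partial maps, a crystal generated by one element is
indecomposable. An embedding restricts to isomorphisms between generated subcrystals, and `ψ` maps
`b_0^{⊗ m} ⊗ z^n` to the linear path (`psi_bZero`).
-/

namespace PathCrystal

/-! ### Normality and embeddings of crystals -/

namespace CrystalOps

variable {I W B B₁ B₂ : Type*}

theorem iterate_bind_none (E : B → Option B) (k : ℕ) :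
    (fun x : Option B => x.bind E)^[k] none = none :=
  Function.iterate_fixed (by simp) k

/-- A partial map which lowers a natural number `N` by one where it is defined, and which is defined
exactly where `N` is positive, can be iterated exactly `N` times. -/
theorem isGreatest_iterate_bind {E : B → Option B} {N : B → ℕ} (h₀ : ∀ b, E b = none ↔ N b = 0)
    (h₁ : ∀ b b', E b = some b' → N b' + 1 = N b) (b : B) :
    IsGreatest {k : ℕ | (fun x : Option B => x.bind E)^[k] (some b) ≠ none} (N b) := by
  have key : ∀ (k : ℕ) (b : B),
      (fun x : Option B => x.bind E)^[k] (some b) ≠ none ↔ k ≤ N b := by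
    intro k
    induction k with
    | zero => simp
    | succ k ih =>
      intro b
      rw [Function.iterate_succ_apply, Option.bind_some]
      cases hb : E b with
      | none => simp [iterate_bind_none, (h₀ b).1 hb]
      | some b' =>
        have := h₁ b b' hb
        rw [ih b']
        omega
  exact ⟨(key _ b).2 le_rfl, fun k hk => (key k b).1 hk⟩

theorem isNormal_of_nat [AddCommGroup W] {C : CrystalOps I W B} {D : RootDatum I W}
    (hC : C.IsCrystal D) {Ne Nf : I → B → ℕ} (hε : ∀ i b, C.ε i b = ((Ne i b : ℤ) : WithBot ℤ))
    (hφ : ∀ i b, C.φ i b = ((Nf i b : ℤ) : WithBot ℤ)) (he : ∀ i b, C.e i b = none ↔ Ne i b = 0)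
    (hf : ∀ i b, C.f i b = none ↔ Nf i b = 0) : C.IsNormal := by
  refine fun i b => ⟨⟨Ne i b, hε i b, isGreatest_iterate_bind (he i) (fun b b' h => ?_) b⟩,
    Nf i b, hφ i b, isGreatest_iterate_bind (hf i) (fun b b' h => ?_) b⟩
  · have := hC.eps_e i b b' h
    rw [hε, hε, ← WithBot.coe_add, WithBot.coe_inj] at this
    omega
  · have := hC.phi_f i b b' h
    rw [hφ, hφ, ← WithBot.coe_add, WithBot.coe_inj] at this
    omega

/-- A map of the underlying sets that is compatible with all operations of a crystal, including the
places where `e_i` and `f_i` vanish. -/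
structure Embeds (C₁ : CrystalOps I W B₁) (C₂ : CrystalOps I W B₂) (g : B₁ → B₂) : Prop where
  e : ∀ i b, (C₁.e i b).map g = C₂.e i (g b)
  f : ∀ i b, (C₁.f i b).map g = C₂.f i (g b)
  eps : ∀ i b, C₂.ε i (g b) = C₁.ε i b
  phi : ∀ i b, C₂.φ i (g b) = C₁.φ i b
  wt : ∀ b, C₂.wt (g b) = C₁.wt b
  injective : Function.Injective g

namespace Embeds

variable {C₁ : CrystalOps I W B₁} {C₂ : CrystalOps I W B₂} {g : B₁ → B₂}

theorem e_eq_some (H : Embeds C₁ C₂ g) {i : I} {b b' : B₁} :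
    C₁.e i b = some b' ↔ C₂.e i (g b) = some (g b') := by
  rw [← H.e, ← Option.map_some, (Option.map_injective H.injective).eq_iff]

theorem f_eq_some (H : Embeds C₁ C₂ g) {i : I} {b b' : B₁} :
    C₁.f i b = some b' ↔ C₂.f i (g b) = some (g b') := by
  rw [← H.f, ← Option.map_some, (Option.map_injective H.injective).eq_iff]

/-- The axioms of a crystal pass to a source embedded in a crystal. -/
theorem isCrystal [AddCommGroup W] {D : RootDatum I W} (H : Embeds C₁ C₂ g)
    (h : C₂.IsCrystal D) : C₁.IsCrystal D where
  phi_eq i b := by rw [← H.phi, ← H.eps, ← H.wt, h.phi_eq]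
  wt_e i b b' hb := by rw [← H.wt, ← H.wt, h.wt_e _ _ _ (H.e_eq_some.1 hb)]
  eps_e i b b' hb := by rw [← H.eps, ← H.eps, h.eps_e _ _ _ (H.e_eq_some.1 hb)]
  phi_e i b b' hb := by rw [← H.phi, ← H.phi, h.phi_e _ _ _ (H.e_eq_some.1 hb)]
  wt_f i b b' hb := by rw [← H.wt, ← H.wt, h.wt_f _ _ _ (H.f_eq_some.1 hb)]
  eps_f i b b' hb := by rw [← H.eps, ← H.eps, h.eps_f _ _ _ (H.f_eq_some.1 hb)]
  phi_f i b b' hb := by rw [← H.phi, ← H.phi, h.phi_f _ _ _ (H.f_eq_some.1 hb)]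
  inverse i b b' := by rw [H.e_eq_some, H.f_eq_some, h.inverse]
  phi_bot i b hb := by
    have := h.phi_bot i (g b) (by rw [H.phi, hb])
    rwa [← H.e, ← H.f, Option.map_eq_none_iff, Option.map_eq_none_iff] at this

theorem map_iterate_bind {E₁ : B₁ → Option B₁} {E₂ : B₂ → Option B₂}
    (h : ∀ b, (E₁ b).map g = E₂ (g b)) (k : ℕ) (x : Option B₁) :
    ((fun x : Option B₁ => x.bind E₁)^[k] x).map g =
      (fun x : Option B₂ => x.bind E₂)^[k] (x.map g) := by
  refine (Function.Semiconj.iterate_right (f := Option.map g) (fun x => ?_) k) x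
  cases x with
  | none => rfl
  | some b => simp [h]

/-- Normality passes to a source embedded in a normal crystal. -/
theorem isNormal (H : Embeds C₁ C₂ g) (h : C₂.IsNormal) : C₁.IsNormal := by
  intro i b
  have he : ∀ k, (fun x : Option B₂ => x.bind (C₂.e i))^[k] (some (g b)) ≠ none ↔
      (fun x : Option B₁ => x.bind (C₁.e i))^[k] (some b) ≠ none := fun k => by
    rw [← Option.map_some, ← map_iterate_bind (H.e i), Ne, Option.map_eq_none_iff]
  have hf : ∀ k, (fun x : Option B₂ => x.bind (C₂.f i))^[k] (some (g b)) ≠ none ↔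
      (fun x : Option B₁ => x.bind (C₁.f i))^[k] (some b) ≠ none := fun k => by
    rw [← Option.map_some, ← map_iterate_bind (H.f i), Ne, Option.map_eq_none_iff]
  simpa only [H.eps, H.phi, he, hf] using h i (g b)

theorem isStrictMorphism (H : Embeds C₁ C₂ g) : IsStrictMorphism C₁ C₂ (Option.map g) where
  map_zero := rfl
  eps i b c h := by cases h; exact H.eps i b
  wt b c h := by cases h; exact H.wt b
  e i b c h _ := by cases h; exact H.e i b
  f i b c h _ := by cases h; exact H.f i b
  comm_e i x := by
    cases x with
    | none => rfl
    | some b => exact H.e i b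
  comm_f i x := by
    cases x with
    | none => rfl
    | some b => exact H.f i b

theorem isSub_range (H : Embeds C₁ C₂ g) : C₂.IsSub (Set.range g) := by
  rintro i _ ⟨b, rfl⟩ c (h | h)
  · rw [← H.e, Option.map_eq_some_iff] at h
    obtain ⟨b', -, rfl⟩ := h
    exact ⟨b', rfl⟩
  · rw [← H.f, Option.map_eq_some_iff] at h
    obtain ⟨b', -, rfl⟩ := h
    exact ⟨b', rfl⟩

theorem map_act (H : Embeds C₁ C₂ g) (u : List (Bool × I)) (x : Option B₁) :
    (C₁.act u x).map g = C₂.act u (x.map g) := by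
  induction u with
  | nil => rfl
  | cons a u ih =>
    obtain ⟨c, i⟩ := a
    cases c
    · rw [act, act, ← ih, H.isStrictMorphism.comm_f]
    · rw [act, act, ← ih, H.isStrictMorphism.comm_e]

theorem map_mem_generated (H : Embeds C₁ C₂ g) {b b' : B₁} (h : b' ∈ C₁.generated b) :
    g b' ∈ C₂.generated (g b) := by
  obtain ⟨u, hu⟩ := h
  exact ⟨u, by rw [← Option.map_some, ← H.map_act, hu, Option.map_some]⟩

/-- An embedding maps the subcrystal generated by `b` isomorphically onto the one generated by the
image of `b`. -/
theorem isomorphic_generatedSub (H : Embeds C₁ C₂ g) (b : B₁) :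
    Isomorphic (C₁.generatedSub b) (C₂.generatedSub (g b)) := by
  let g' : C₁.generated b → C₂.generated (g b) := fun x => ⟨g x.1, H.map_mem_generated x.2⟩
  have hinj : Function.Injective g' := fun x y h =>
    Subtype.ext (H.injective (congrArg Subtype.val h))
  have hsurj : Function.Surjective g' := by
    rintro ⟨c, u, hu⟩
    rw [← Option.map_some, ← H.map_act, Option.map_eq_some_iff] at hu
    obtain ⟨b', hb', rfl⟩ := hu
    exact ⟨⟨b', u, hb'⟩, rfl⟩
  have hG : Embeds (C₁.generatedSub b) (C₂.generatedSub (g b)) g' := by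
    refine ⟨fun i x => ?_, fun i x => ?_, fun i x => H.eps i x.1, fun i x => H.phi i x.1,
      fun x => H.wt x.1, hinj⟩
    · apply Option.map_injective Subtype.val_injective
      simp only [generatedSub, restrict, Option.map_pmap]
      simp only [g', ← H.e, Option.pmap_eq_map, Option.map_id']
    · apply Option.map_injective Subtype.val_injective
      simp only [generatedSub, restrict, Option.map_pmap]
      simp only [g', ← H.f, Option.pmap_eq_map, Option.map_id']
  exact ⟨Equiv.ofBijective g' ⟨hinj, hsurj⟩, hG.isStrictMorphism⟩

end Embeds

/-- Since `e_i` and `f_i` are inverse to each other, a subcrystal that contains a monomial image of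
an element contains the element itself. -/
theorem IsSub.mem_of_act [AddCommGroup W] {C : CrystalOps I W B} {D : RootDatum I W}
    (hC : C.IsCrystal D) {S : Set B} (hS : C.IsSub S) {u : List (Bool × I)} {b b' : B}
    (h : C.act u (some b) = some b') (hb' : b' ∈ S) : b ∈ S := by
  induction u generalizing b' with
  | nil => cases h; exact hb'
  | cons a u ih =>
    obtain ⟨c, i⟩ := a
    cases c <;> rw [act, Option.bind_eq_some_iff] at h <;> obtain ⟨x, hx, h⟩ := h
    · exact ih hx (hS i b' hb' x (Or.inl ((hC.inverse i b' x).2 h)))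
    · exact ih hx (hS i b' hb' x (Or.inr ((hC.inverse i x b').1 h)))

theorem IsSub.act_mem {C : CrystalOps I W B} {S : Set B} (hS : C.IsSub S)
    {u : List (Bool × I)} {b b' : B} (h : C.act u (some b) = some b') (hb : b ∈ S) : b' ∈ S := by
  induction u generalizing b' with
  | nil => cases h; exact hb
  | cons a u ih =>
    obtain ⟨c, i⟩ := a
    cases c <;> rw [act, Option.bind_eq_some_iff] at h <;> obtain ⟨x, hx, h⟩ := h
    · exact hS i x (ih hx) b' (Or.inr h)
    · exact hS i x (ih hx) b' (Or.inl h)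

theorem indecomposable_generatedSub [AddCommGroup W] {C : CrystalOps I W B} {D : RootDatum I W}
    (hC : C.IsCrystal D) (b : B) : (C.generatedSub b).Indecomposable := by
  rintro S hS ⟨⟨c, u, hu⟩, hc⟩
  have hS' : C.IsSub (Subtype.val '' S) := by
    rintro i _ ⟨x, hx, rfl⟩ b' h
    have hb' : b' ∈ C.generated b := C.isSub_generated b i x.1 x.2 b' h
    refine ⟨⟨b', hb'⟩, hS i x hx _ (h.imp (fun h => ?_) fun h => ?_), rfl⟩
    · simp [generatedSub, restrict, h]
    · simp [generatedSub, restrict, h]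
  have hb : b ∈ Subtype.val '' S := hS'.mem_of_act hC hu ⟨_, hc, rfl⟩
  refine Set.eq_univ_of_forall fun x => ?_
  obtain ⟨v, hv⟩ := x.2
  obtain ⟨y, hy, hyx⟩ := hS'.act_mem hv hb
  rwa [Subtype.ext hyx] at hy

end CrystalOps

/-! ### Piecewise-linear functions -/

namespace IsPL

variable {V V' : Type*} [AddCommGroup V] [Module ℚ V] [AddCommGroup V'] [Module ℚ V']

/-- A relation that holds between the end points of all intervals on which `g` is affine, and that
is inherited by the union of two adjacent intervals, holds between any two points. -/
theorem induction_on {g : UnitQ → V} (hg : IsPL g) {R : UnitQ → UnitQ → Prop}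
    (affine : ∀ x y, x ≤ y → ∀ u v : V, (∀ τ : UnitQ, x ≤ τ → τ ≤ y → g τ = u + (τ : ℚ) • v) →
      R x y)
    (trans : ∀ x s y, x ≤ s → s ≤ y → R x s → R s y → R x y) (x y : UnitQ) (hxy : x ≤ y) :
    R x y := by
  obtain ⟨S, hS⟩ := hg
  have key : ∀ n : ℕ, ∀ x y : UnitQ, x ≤ y → (S.filter fun s => x < s ∧ s < y).card = n →
      R x y := by
    intro n
    induction n using Nat.strong_induction_on with
    | _ n ih =>
      intro x y hxy hn
      by_cases hs : ∃ s ∈ S, x < s ∧ s < y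
      · obtain ⟨s, hsS, hxs, hsy⟩ := hs
        refine trans x s y hxs.le hsy.le (ih _ ?_ x s hxs.le rfl) (ih _ ?_ s y hsy.le rfl) <;>
          rw [← hn] <;> refine Finset.card_lt_card ⟨fun r hr => ?_, fun hsub => ?_⟩
        · rw [Finset.mem_filter] at hr ⊢
          exact ⟨hr.1, hr.2.1, hr.2.2.trans hsy⟩
        · exact lt_irrefl _ (Finset.mem_filter.1 (hsub (Finset.mem_filter.2 ⟨hsS, hxs, hsy⟩))).2.2
        · rw [Finset.mem_filter] at hr ⊢
          exact ⟨hr.1, hxs.trans hr.2.1, hr.2.2⟩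
        · exact lt_irrefl _ (Finset.mem_filter.1 (hsub (Finset.mem_filter.2 ⟨hsS, hxs, hsy⟩))).2.1
      · push Not at hs
        obtain ⟨u, v, huv⟩ := hS x y fun s hsS h => not_lt.2 (hs s hsS h.1) h.2
        exact affine x y hxy u v huv
  exact key _ x y hxy rfl

theorem map {g : UnitQ → V} (hg : IsPL g) (F : V →ₗ[ℚ] V') : IsPL fun τ => F (g τ) := by
  obtain ⟨S, hS⟩ := hg
  refine ⟨S, fun x y hxy => ?_⟩
  obtain ⟨u, v, huv⟩ := hS x y hxy
  exact ⟨F u, F v, fun τ h₁ h₂ => by beta_reduce; rw [huv τ h₁ h₂, map_add, map_smul]⟩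

theorem comp_min {g : UnitQ → V} (hg : IsPL g) (p : UnitQ) : IsPL fun τ => g (min τ p) := by
  obtain ⟨S, hS⟩ := hg
  refine ⟨insert p S, fun x y hxy => ?_⟩
  by_cases hy : y ≤ p
  · obtain ⟨u, v, huv⟩ := hS x y fun s hs => hxy s (Finset.mem_insert_of_mem hs)
    exact ⟨u, v, fun τ h₁ h₂ => by beta_reduce; rw [min_eq_left (h₂.trans hy), huv τ h₁ h₂]⟩
  · have hx : p ≤ x := not_lt.1 fun h => hxy p (Finset.mem_insert_self _ _) ⟨h, not_le.1 hy⟩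
    exact ⟨g p, 0, fun τ h₁ _ => by
      beta_reduce
      rw [min_eq_right (hx.trans h₁), smul_zero, add_zero]⟩

theorem comp_max {g : UnitQ → V} (hg : IsPL g) (q : UnitQ) : IsPL fun τ => g (max τ q) := by
  obtain ⟨S, hS⟩ := hg
  refine ⟨insert q S, fun x y hxy => ?_⟩
  by_cases hx : q ≤ x
  · obtain ⟨u, v, huv⟩ := hS x y fun s hs => hxy s (Finset.mem_insert_of_mem hs)
    exact ⟨u, v, fun τ h₁ h₂ => by beta_reduce; rw [max_eq_left (hx.trans h₁), huv τ h₁ h₂]⟩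
  · have hy : y ≤ q := not_lt.1 fun h => hxy q (Finset.mem_insert_self _ _) ⟨not_le.1 hx, h⟩
    exact ⟨g q, 0, fun τ _ h₂ => by
      beta_reduce
      rw [max_eq_right (h₂.trans hy), smul_zero, add_zero]⟩

theorem neg {g : UnitQ → V} (hg : IsPL g) : IsPL fun τ => -g τ :=
  hg.map (-LinearMap.id)

theorem exists_le {g : UnitQ → ℚ} (hg : IsPL g) : ∃ M, ∀ τ, g τ ≤ M := by
  have key : ∃ M, ∀ τ : UnitQ, 0 ≤ τ → τ ≤ 1 → g τ ≤ M := by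
    refine hg.induction_on (R := fun x y => ∃ M, ∀ τ, x ≤ τ → τ ≤ y → g τ ≤ M)
      (fun x y hxy u v huv => ⟨u + |v|, fun τ h₁ h₂ => ?_⟩)
      (fun x s y _ _ ⟨M₁, h₁⟩ ⟨M₂, h₂⟩ => ⟨max M₁ M₂, fun τ hx hy => ?_⟩) 0 1 (zero_le_one' ℚ)
    · rw [huv τ h₁ h₂, smul_eq_mul]
      have h₃ : (τ : ℚ) * v ≤ τ * |v| := mul_le_mul_of_nonneg_left (le_abs_self v) τ.2.1
      have h₄ : (τ : ℚ) * |v| ≤ 1 * |v| := mul_le_mul_of_nonneg_right τ.2.2 (abs_nonneg v)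
      linarith
    · rcases le_total τ s with h | h
      · exact (h₁ τ hx h).trans (le_max_left _ _)
      · exact (h₂ τ h hy).trans (le_max_right _ _)
  obtain ⟨M, hM⟩ := key
  exact ⟨M, fun τ => hM τ τ.2.1 τ.2.2⟩

/-- The intermediate value theorem over `ℚ`. -/
theorem exists_eq {g : UnitQ → ℚ} (hg : IsPL g) {x y : UnitQ} (hxy : x ≤ y) {c : ℚ}
    (hx : g x ≤ c) (hy : c ≤ g y) : ∃ τ, x ≤ τ ∧ τ ≤ y ∧ g τ = c := by
  refine hg.induction_on (R := fun x y => g x ≤ c → c ≤ g y → ∃ τ, x ≤ τ ∧ τ ≤ y ∧ g τ = c)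
    (fun x y hxy u v huv hx hy => ?_) (fun x s y hxs hsy h₁ h₂ hx hy => ?_) x y hxy hx hy
  · have hx' := huv x le_rfl hxy
    have hy' := huv y hxy le_rfl
    rw [smul_eq_mul] at hx' hy'
    rcases hx.eq_or_lt with h | h
    · exact ⟨x, le_rfl, hxy, h⟩
    have hxy' : (x : ℚ) ≤ y := hxy
    have hv : 0 < v := by
      by_contra! hv
      nlinarith
    have h₁ : (x : ℚ) ≤ (c - u) / v := by rw [le_div_iff₀ hv]; linarith
    have h₂ : (c - u) / v ≤ y := by rw [div_le_iff₀ hv]; linarith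
    refine ⟨⟨(c - u) / v, x.2.1.trans h₁, h₂.trans y.2.2⟩, h₁, h₂, ?_⟩
    rw [huv _ h₁ h₂, smul_eq_mul, div_mul_cancel₀ _ hv.ne']
    ring
  · rcases le_total c (g s) with h | h
    · obtain ⟨τ, h₃, h₄, h₅⟩ := h₁ hx h
      exact ⟨τ, h₃, h₄.trans hsy, h₅⟩
    · obtain ⟨τ, h₃, h₄, h₅⟩ := h₂ h hy
      exact ⟨τ, hxs.trans h₃, h₄, h₅⟩

theorem exists_eq' {g : UnitQ → ℚ} (hg : IsPL g) {x y : UnitQ} (hxy : x ≤ y) {c : ℚ}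
    (hx : c ≤ g x) (hy : g y ≤ c) : ∃ τ, x ≤ τ ∧ τ ≤ y ∧ g τ = c := by
  obtain ⟨τ, h₁, h₂, h₃⟩ := hg.neg.exists_eq hxy (c := -c) (neg_le_neg hx) (neg_le_neg hy)
  exact ⟨τ, h₁, h₂, neg_injective h₃⟩

theorem exists_isGreatest_le {g : UnitQ → ℚ} (hg : IsPL g) {c : ℚ} {p : UnitQ} (hp : g p ≠ c)
    (h : ∃ τ ≤ p, g τ = c) : ∃ q, IsGreatest {τ | τ ≤ p ∧ g τ = c} q := by
  obtain ⟨τ, hτ, hc⟩ := h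
  obtain ⟨q, hq, hq'⟩ := ((hg.comp_min p).exists_extrema (c := c) ⟨τ, by rw [min_eq_left hτ, hc]⟩).2
  have hlt : q ≤ p := by
    by_contra! hlt
    exact hp (by rw [← hq, min_eq_right hlt.le])
  refine ⟨q, ⟨hlt, ?_⟩, fun σ hσ => hq' ?_⟩
  · rw [← hq, min_eq_left hlt]
  · rw [Set.mem_ofPred_eq, min_eq_left hσ.1, hσ.2]

theorem exists_isLeast_ge {g : UnitQ → ℚ} (hg : IsPL g) {c : ℚ} {q : UnitQ} (hq : g q ≠ c)
    (h : ∃ τ, q ≤ τ ∧ g τ = c) : ∃ p, IsLeast {τ | q ≤ τ ∧ g τ = c} p := by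
  obtain ⟨τ, hτ, hc⟩ := h
  obtain ⟨p, hp, hp'⟩ := ((hg.comp_max q).exists_extrema (c := c) ⟨τ, by rw [max_eq_left hτ, hc]⟩).1
  have hlt : q ≤ p := by
    by_contra! hlt
    exact hq (by rw [← hp, max_eq_right hlt.le])
  refine ⟨p, ⟨hlt, ?_⟩, fun σ hσ => hp' ?_⟩
  · rw [← hp, max_eq_left hlt]
  · rw [Set.mem_ofPred_eq, max_eq_left hσ.1, hσ.2]

end IsPL

/-! ### The path crystal -/

theorem ne_sub_one {ℓ : ℕ} (i : Fin (ℓ + 1)) (hℓ : 1 ≤ ℓ) : i ≠ i - 1 := by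
  intro h
  have h1 : (1 : Fin (ℓ + 1)) = 0 := by simpa using h.symm
  rw [Fin.ext_iff, Fin.val_one', Fin.val_zero, Nat.mod_eq_of_lt (by omega)] at h1
  exact one_ne_zero h1

namespace Path

variable {ℓ : ℕ} {b : Path ℓ} {i : Fin (ℓ + 1)} {q p : UnitQ}

theorem ext' {b₁ b₂ : Path ℓ} (h : ∀ τ, b₁.toFun τ = b₂.toFun τ) : b₁ = b₂ := by
  have hw : b₁.wt = b₂.wt := toQP_injective (by rw [← b₁.map_one, ← b₂.map_one, h])
  obtain ⟨f₁, _, _, w₁, _⟩ := b₁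
  obtain ⟨f₂, _, _, w₂, _⟩ := b₂
  obtain rfl : f₁ = f₂ := funext h
  obtain rfl : w₁ = w₂ := hw
  rfl

theorem isPL_h (b : Path ℓ) (i : Fin (ℓ + 1)) : IsPL (b.h i) :=
  b.isPL.map (-(LinearMap.proj i ∘ₗ LinearMap.fst ℚ _ _))

theorem h_zero (b : Path ℓ) (i : Fin (ℓ + 1)) : b.h i 0 = 0 := by simp [h, b.map_zero]

theorem h_one (b : Path ℓ) (i : Fin (ℓ + 1)) : b.h i 1 = (-b.wt.1 i : ℤ) := by
  simp [h, b.map_one, toQP]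

theorem eps_isGreatest (b : Path ℓ) (i : Fin (ℓ + 1)) :
    IsGreatest {n : ℤ | ∃ τ, b.h i τ = n} (b.eps i) := by
  obtain ⟨M, hM⟩ := (b.isPL_h i).exists_le
  have hne : {n : ℤ | ∃ τ, b.h i τ = n}.Nonempty := ⟨0, 0, by simp [h_zero]⟩
  have hbdd : BddAbove {n : ℤ | ∃ τ, b.h i τ = n} := by
    refine ⟨⌊M⌋, fun n ⟨τ, hτ⟩ => Int.le_floor.2 ?_⟩
    rw [← hτ]
    exact hM τ
  exact ⟨Int.csSup_mem hne hbdd, fun n hn => le_csSup hbdd hn⟩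

theorem eps_eq {n : ℤ} (h : IsGreatest {n : ℤ | ∃ τ, b.h i τ = n} n) : b.eps i = n :=
  (b.eps_isGreatest i).unique h

theorem eps_nonneg (b : Path ℓ) (i : Fin (ℓ + 1)) : 0 ≤ b.eps i :=
  (b.eps_isGreatest i).2 ⟨0, by simp [h_zero]⟩

theorem phi_nonneg (b : Path ℓ) (i : Fin (ℓ + 1)) : 0 ≤ b.eps i + b.wt.1 i := by
  have : -b.wt.1 i ≤ b.eps i := (b.eps_isGreatest i).2 ⟨1, b.h_one i⟩
  omega

theorem le_eps (b : Path ℓ) (i : Fin (ℓ + 1)) {n : ℤ} {τ : UnitQ} (h : b.h i τ = n) :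
    n ≤ b.eps i := (b.eps_isGreatest i).2 ⟨τ, h⟩

theorem exists_isRaising (h : b.eps i ≠ 0) : ∃ q p, b.IsRaising i q p := by
  have hpos : 0 < b.eps i := (b.eps_nonneg i).lt_of_ne' h
  obtain ⟨p, hp⟩ := ((b.isPL_h i).exists_extrema (b.eps_isGreatest i).1).1
  have hp' : b.h i p = b.eps i := hp.1
  have hpos' : (1 : ℚ) ≤ b.eps i := by exact_mod_cast hpos
  obtain ⟨τ, -, hτ⟩ := (b.isPL_h i).exists_eq (x := 0) (y := p) (c := b.eps i - 1) p.2.1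
    (by rw [h_zero]; linarith) (by rw [hp']; linarith)
  obtain ⟨q, hq⟩ := (b.isPL_h i).exists_isGreatest_le (p := p) (c := b.eps i - 1)
    (by rw [hp']; linarith) ⟨τ, hτ⟩
  refine ⟨q, p, hp, ?_, hq⟩
  rintro rfl
  rw [h_zero] at hp'
  linarith

theorem exists_isLowering (h : b.eps i + b.wt.1 i ≠ 0) : ∃ q p, b.IsLowering i q p := by
  have hpos : 0 < b.eps i + b.wt.1 i := (b.phi_nonneg i).lt_of_ne' h
  obtain ⟨q, hq⟩ := ((b.isPL_h i).exists_extrema (b.eps_isGreatest i).1).2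
  have hq' : b.h i q = b.eps i := hq.1
  have hpos' : (1 : ℚ) ≤ b.eps i + b.wt.1 i := by exact_mod_cast hpos
  have h1 : b.h i 1 = -b.wt.1 i := by rw [h_one]; push_cast; rfl
  obtain ⟨τ, hτ, -, hτ'⟩ := (b.isPL_h i).exists_eq' (x := q) (y := 1) (c := b.eps i - 1) q.2.2
    (by rw [hq']; linarith) (by rw [h1]; linarith)
  obtain ⟨p, hp⟩ := (b.isPL_h i).exists_isLeast_ge (q := q) (c := b.eps i - 1)
    (by rw [hq']; linarith) ⟨τ, hτ, hτ'⟩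
  refine ⟨q, p, hq, ?_, hp⟩
  rintro rfl
  rw [h1] at hq'
  linarith

theorem IsRaising.eps_ne_zero (H : b.IsRaising i q p) : b.eps i ≠ 0 := fun h =>
  H.ne_zero (le_antisymm (H.least.2 (by rw [Set.mem_ofPred_eq, h_zero, h, Int.cast_zero])) p.2.1)

theorem IsLowering.phi_ne_zero (H : b.IsLowering i q p) : b.eps i + b.wt.1 i ≠ 0 := fun h =>
  H.ne_one (le_antisymm q.2.2 (H.greatest.2 (by
    rw [Set.mem_ofPred_eq, h_one, eq_neg_of_add_eq_zero_left h])))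

theorem e_eq_some_iff {b' : Path ℓ} : b.e i = some b' ↔
    ∃ q p, ∃ H : b.IsRaising i q p, b' = b.bend i q p (simpleRoot i) H.le H.fits := by
  rw [e]
  split_ifs with H
  · rw [Option.some.injEq]
    constructor
    · rintro rfl
      exact ⟨_, _, H.choose_spec, rfl⟩
    · rintro ⟨q, p, h, rfl⟩
      obtain ⟨h₁, h₂⟩ := H.choose_spec.unique h
      congr
  · simp only [false_iff]
    rintro ⟨q, p, h, -⟩
    exact H ⟨(q, p), h⟩

theorem f_eq_some_iff {b' : Path ℓ} : b.f i = some b' ↔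
    ∃ q p, ∃ H : b.IsLowering i q p, b' = b.bend i q p (-simpleRoot i) H.le H.fits := by
  rw [f]
  split_ifs with H
  · rw [Option.some.injEq]
    constructor
    · rintro rfl
      exact ⟨_, _, H.choose_spec, rfl⟩
    · rintro ⟨q, p, h, rfl⟩
      obtain ⟨h₁, h₂⟩ := H.choose_spec.unique h
      congr
  · simp only [false_iff]
    rintro ⟨q, p, h, -⟩
    exact H ⟨(q, p), h⟩

theorem e_eq_none_iff : b.e i = none ↔ b.eps i = 0 := by
  rw [← not_iff_not, ← Ne, Option.ne_none_iff_exists']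
  constructor
  · rintro ⟨b', h⟩
    obtain ⟨q, p, H, -⟩ := e_eq_some_iff.1 h
    exact H.eps_ne_zero
  · intro h
    obtain ⟨q, p, H⟩ := exists_isRaising h
    exact ⟨_, e_eq_some_iff.2 ⟨q, p, H, rfl⟩⟩

theorem f_eq_none_iff : b.f i = none ↔ b.eps i + b.wt.1 i = 0 := by
  rw [← not_iff_not, ← Ne, Option.ne_none_iff_exists']
  constructor
  · rintro ⟨b', h⟩
    obtain ⟨q, p, H, -⟩ := f_eq_some_iff.1 h
    exact H.phi_ne_zero
  · intro h
    obtain ⟨q, p, H⟩ := exists_isLowering h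
    exact ⟨_, f_eq_some_iff.2 ⟨q, p, H, rfl⟩⟩

theorem simpleRoot_self (hℓ : 1 ≤ ℓ) (i : Fin (ℓ + 1)) : (simpleRoot i).1 i = 2 := by
  have h₁ := ne_sub_one i hℓ
  have h₂ : i ≠ i + 1 := fun h => ne_sub_one (i + 1) hℓ (by rw [add_sub_cancel_right, ← h])
  simp [simpleRoot, Lam, h₁, h₂]

theorem reflection_self (hℓ : 1 ≤ ℓ) (v : QP ℓ) : (reflection i v).1 i = -v.1 i := by
  simp only [reflection, toQP, Prod.fst_sub, Prod.smul_fst, Pi.sub_apply, Pi.smul_apply,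
    simpleRoot_self hℓ, smul_eq_mul]
  push_cast
  ring

theorem reflection_reflection (hℓ : 1 ≤ ℓ) (v : QP ℓ) : reflection i (reflection i v) = v := by
  rw [reflection, reflection_self hℓ, reflection]
  module

section Bend

variable {γ : P ℓ} {hqp : q ≤ p}
  {hγ : reflection i (b.toFun p - b.toFun q) + b.toFun q = b.toFun p + toQP γ} {τ : UnitQ}

theorem toFun_bend : (b.bend i q p γ hqp hγ).toFun τ = b.bendFun i q p γ τ := rfl

theorem h_bend_left (hτ : τ ≤ q) : (b.bend i q p γ hqp hγ).h i τ = b.h i τ := by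
  rw [h, h, toFun_bend, bendFun_left hτ]

theorem h_bend_mid (hℓ : 1 ≤ ℓ) (h₁ : q ≤ τ) (h₂ : τ ≤ p) :
    (b.bend i q p γ hqp hγ).h i τ = 2 * b.h i q - b.h i τ := by
  rw [h, h, h, toFun_bend, bendFun_mid h₁ h₂, Prod.fst_add, Pi.add_apply, reflection_self hℓ,
    Prod.fst_sub, Pi.sub_apply]
  ring

theorem h_bend_right (hτ : p ≤ τ) :
    (b.bend i q p γ hqp hγ).h i τ = b.h i τ - γ.1 i := by
  rw [h, h, toFun_bend, bendFun_right hqp hγ hτ, Prod.fst_add, Pi.add_apply, toQP]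
  ring

/-- Bending a second time at the same places, with the opposite shift, restores the path. -/
theorem bend_bend (hℓ : 1 ≤ ℓ) {γ' : P ℓ} (hγγ' : γ + γ' = 0) {h₁ h₂} :
    (b.bend i q p γ hqp hγ).bend i q p γ' h₁ h₂ = b := by
  have hq : (b.bend i q p γ hqp hγ).toFun q = b.toFun q := bendFun_left le_rfl
  refine ext' fun τ => ?_
  change (b.bend i q p γ hqp hγ).bendFun i q p γ' τ = _
  rcases le_total τ q with h | h
  · rw [bendFun_left h]
    exact bendFun_left h
  rcases le_total τ p with h' | h'
  · rw [bendFun_mid h h', hq, toFun_bend, bendFun_mid h h', add_sub_cancel_right,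
      reflection_reflection hℓ, sub_add_cancel]
  · rw [bendFun_right h₁ h₂ h', toFun_bend, bendFun_right hqp hγ h', add_assoc,
      show toQP γ + toQP γ' = 0 by
        rw [eq_neg_of_add_eq_zero_left hγγ']; ext <;> simp [toQP], add_zero]

end Bend

/-- On the interval that is reflected by `e_i`, the function `h^i` stays above `ε_i - 1`. -/
theorem IsRaising.le_h (H : b.IsRaising i q p) {τ : UnitQ} (h₁ : q ≤ τ) (h₂ : τ ≤ p) :
    (b.eps i - 1 : ℚ) ≤ b.h i τ := by
  by_contra! hlt
  have hp : b.h i p = b.eps i := H.least.1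
  obtain ⟨σ, h₃, h₄, h₅⟩ := (b.isPL_h i).exists_eq h₂ hlt.le (by rw [hp]; linarith)
  have : σ ≤ q := H.greatest.2 ⟨h₄, h₅⟩
  rw [le_antisymm (h₃.trans this) h₁, H.greatest.1.2] at hlt
  exact lt_irrefl _ hlt

theorem IsLowering.le_h (H : b.IsLowering i q p) {τ : UnitQ} (h₁ : q ≤ τ) (h₂ : τ ≤ p) :
    (b.eps i - 1 : ℚ) ≤ b.h i τ := by
  by_contra! hlt
  have hq : b.h i q = b.eps i := H.greatest.1
  obtain ⟨σ, h₃, h₄, h₅⟩ := (b.isPL_h i).exists_eq' h₁ (by rw [hq]; linarith) hlt.le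
  have : p ≤ σ := H.least.2 ⟨h₃, h₅⟩
  rw [← le_antisymm (this.trans h₄) h₂, H.least.1.2] at hlt
  exact lt_irrefl _ hlt

/-- The path `e_i p` has `ε_i(e_i p) = ε_i(p) - 1`, and it is lowered at the places where `p` was
raised. -/
theorem IsRaising.isLowering_bend (hℓ : 1 ≤ ℓ) (H : b.IsRaising i q p) :
    (b.bend i q p (simpleRoot i) H.le H.fits).eps i = b.eps i - 1 ∧
      (b.bend i q p (simpleRoot i) H.le H.fits).IsLowering i q p := by
  set b' := b.bend i q p (simpleRoot i) H.le H.fits with hb'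
  have hp : b.h i p = b.eps i := H.least.1
  have hq : b.h i q = b.eps i - 1 := H.greatest.1.2
  have hl : ∀ τ ≤ q, b'.h i τ = b.h i τ := fun τ h => h_bend_left h
  have hm : ∀ τ, q ≤ τ → τ ≤ p → b'.h i τ = 2 * (b.eps i - 1) - b.h i τ := fun τ h₁ h₂ => by
    rw [hb', h_bend_mid hℓ h₁ h₂, hq]
  have hr : ∀ τ, p ≤ τ → b'.h i τ = b.h i τ - 2 := fun τ h => by
    rw [hb', h_bend_right h, simpleRoot_self hℓ]
    norm_num
  have hqp : q < p := lt_of_le_of_ne H.le fun h => by rw [h, hp] at hq; linarith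
  have heps : b'.eps i = b.eps i - 1 := by
    refine eps_eq ⟨⟨q, by rw [hl q le_rfl, hq]; push_cast; rfl⟩, ?_⟩
    rintro n ⟨τ, hτ⟩
    rcases le_total τ q with h | h
    · rw [hl τ h] at hτ
      refine Int.le_sub_one_of_lt (lt_of_le_of_ne (b.le_eps i hτ) fun hn => ?_)
      rw [hn] at hτ
      exact not_le.2 hqp ((H.least.2 hτ).trans h)
    rcases le_total τ p with h' | h'
    · rw [hm τ h h'] at hτ
      have := H.le_h h h'
      have : (n : ℚ) ≤ (b.eps i - 1 : ℤ) := by push_cast; linarith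
      exact_mod_cast this
    · rw [hr τ h'] at hτ
      have : n + 2 ≤ b.eps i := b.le_eps i (τ := τ) (by push_cast; linarith)
      omega
  have heps' : (b'.eps i : ℚ) = b.eps i - 1 := by rw [heps]; push_cast; rfl
  refine ⟨heps, ⟨?_, ?_⟩, fun h1 => ?_, ⟨H.le, ?_⟩, ?_⟩
  · rw [Set.mem_ofPred_eq, hl q le_rfl, hq, heps']
  · intro τ hτ
    rw [Set.mem_ofPred_eq, heps'] at hτ
    by_contra! hlt
    rcases le_total τ p with h | h
    · rw [hm τ hlt.le h] at hτ
      exact not_le.2 hlt (H.greatest.2 ⟨h, by linarith⟩)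
    · rw [hr τ h] at hτ
      have := b.le_eps i (n := b.eps i + 1) (τ := τ) (by push_cast; linarith)
      omega
  · exact not_le.2 hqp (h1 ▸ p.2.2)
  · rw [hm p H.le le_rfl, hp, heps']
    ring
  · rintro τ ⟨h, hτ⟩
    by_contra! hlt
    rw [hm τ h hlt.le, heps'] at hτ
    exact not_le.2 hlt (H.least.2 (by rw [Set.mem_ofPred_eq]; linarith))

/-- The path `f_i p` has `ε_i(f_i p) = ε_i(p) + 1`, and it is raised at the places where `p` was
lowered. -/
theorem IsLowering.isRaising_bend (hℓ : 1 ≤ ℓ) (H : b.IsLowering i q p) :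
    (b.bend i q p (-simpleRoot i) H.le H.fits).eps i = b.eps i + 1 ∧
      (b.bend i q p (-simpleRoot i) H.le H.fits).IsRaising i q p := by
  set b' := b.bend i q p (-simpleRoot i) H.le H.fits with hb'
  have hq : b.h i q = b.eps i := H.greatest.1
  have hp : b.h i p = b.eps i - 1 := H.least.1.2
  have hl : ∀ τ ≤ q, b'.h i τ = b.h i τ := fun τ h => h_bend_left h
  have hm : ∀ τ, q ≤ τ → τ ≤ p → b'.h i τ = 2 * b.eps i - b.h i τ := fun τ h₁ h₂ => by
    rw [hb', h_bend_mid hℓ h₁ h₂, hq]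
  have hr : ∀ τ, p ≤ τ → b'.h i τ = b.h i τ + 2 := fun τ h => by
    rw [hb', h_bend_right h, Prod.fst_neg, Pi.neg_apply, simpleRoot_self hℓ]
    norm_num
  have hqp : q < p := lt_of_le_of_ne H.le fun h => by rw [← h, hq] at hp; linarith
  have hbig : ∀ τ, b.h i τ ≠ b.eps i + 1 := fun τ hτ => by
    have := b.le_eps i (n := b.eps i + 1) (τ := τ) (by push_cast; exact hτ)
    omega
  have heps : b'.eps i = b.eps i + 1 := by
    refine eps_eq ⟨⟨p, by rw [hr p le_rfl, hp]; push_cast; ring⟩, ?_⟩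
    rintro n ⟨τ, hτ⟩
    rcases le_total τ q with h | h
    · rw [hl τ h] at hτ
      exact (b.le_eps i hτ).trans (by omega)
    rcases le_total τ p with h' | h'
    · rw [hm τ h h'] at hτ
      have := H.le_h h h'
      have : (n : ℚ) ≤ (b.eps i + 1 : ℤ) := by push_cast; linarith
      exact_mod_cast this
    · rw [hr τ h'] at hτ
      have hτ' : b.h i τ = (n - 2 : ℤ) := by push_cast; linarith
      have h₁ := b.le_eps i hτ'
      have h₂ : n - 2 ≠ b.eps i := fun hn => by
        rw [hn] at hτ'
        exact not_le.2 hqp (h'.trans (H.greatest.2 hτ'))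
      omega
  have heps' : (b'.eps i : ℚ) = b.eps i + 1 := by rw [heps]; push_cast; rfl
  refine ⟨heps, ⟨?_, ?_⟩, fun h0 => ?_, ⟨H.le, ?_⟩, ?_⟩
  · rw [Set.mem_ofPred_eq, hr p le_rfl, hp, heps']
    ring
  · intro τ hτ
    rw [Set.mem_ofPred_eq, heps'] at hτ
    by_contra! hlt
    rcases le_total τ q with h | h
    · rw [hl τ h] at hτ
      exact hbig τ hτ
    · rw [hm τ h hlt.le] at hτ
      exact not_le.2 hlt (H.least.2 ⟨h, by linarith⟩)
  · exact not_le.2 hqp (h0 ▸ q.2.1)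
  · rw [hl q le_rfl, hq, heps']
    ring
  · rintro τ ⟨h, hτ⟩
    by_contra! hlt
    rw [hm τ hlt.le h, heps'] at hτ
    exact not_le.2 hlt (H.greatest.2 (by rw [Set.mem_ofPred_eq]; linarith))

theorem f_of_e (hℓ : 1 ≤ ℓ) {b' : Path ℓ} (h : b.e i = some b') : b'.f i = some b := by
  obtain ⟨q, p, H, rfl⟩ := e_eq_some_iff.1 h
  exact f_eq_some_iff.2 ⟨q, p, (H.isLowering_bend hℓ).2, (bend_bend hℓ (by simp)).symm⟩

theorem e_of_f (hℓ : 1 ≤ ℓ) {b' : Path ℓ} (h : b.f i = some b') : b'.e i = some b := by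
  obtain ⟨q, p, H, rfl⟩ := f_eq_some_iff.1 h
  exact e_eq_some_iff.2 ⟨q, p, (H.isRaising_bend hℓ).2, (bend_bend hℓ (by simp)).symm⟩

theorem eps_e (hℓ : 1 ≤ ℓ) {b' : Path ℓ} (h : b.e i = some b') : b'.eps i = b.eps i - 1 := by
  obtain ⟨q, p, H, rfl⟩ := e_eq_some_iff.1 h
  exact (H.isLowering_bend hℓ).1

theorem wt_e {b' : Path ℓ} (h : b.e i = some b') : b'.wt = b.wt + simpleRoot i := by
  obtain ⟨q, p, H, rfl⟩ := e_eq_some_iff.1 h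
  rfl

end Path

theorem pathCrystal_inverse {ℓ : ℕ} (hℓ : 1 ≤ ℓ) (i : Fin (ℓ + 1)) (x y : PathClass ℓ) :
    (pathCrystal ℓ).e i x = some y ↔ (pathCrystal ℓ).f i y = some x := by
  constructor
  · intro h
    obtain ⟨b, rfl⟩ := Quot.exists_rep x
    obtain ⟨b', hb', rfl⟩ := Option.map_eq_some_iff.1 h
    exact Option.map_eq_some_iff.2 ⟨b, Path.f_of_e hℓ hb', rfl⟩
  · intro h
    obtain ⟨b, rfl⟩ := Quot.exists_rep y
    obtain ⟨b', hb', rfl⟩ := Option.map_eq_some_iff.1 h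
    exact Option.map_eq_some_iff.2 ⟨b, Path.e_of_f hℓ hb', rfl⟩

theorem pathCrystal_of_e {ℓ : ℕ} (hℓ : 1 ≤ ℓ) {i : Fin (ℓ + 1)} {x y : PathClass ℓ}
    (h : (pathCrystal ℓ).e i x = some y) :
    (pathCrystal ℓ).wt y = (pathCrystal ℓ).wt x + simpleRoot i ∧
      (pathCrystal ℓ).ε i y = (pathCrystal ℓ).ε i x + ((-1 : ℤ) : WithBot ℤ) ∧
      (pathCrystal ℓ).φ i y = (pathCrystal ℓ).φ i x + ((1 : ℤ) : WithBot ℤ) := by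
  obtain ⟨b, rfl⟩ := Quot.exists_rep x
  obtain ⟨b', hb', rfl⟩ := Option.map_eq_some_iff.1 h
  have h₁ := Path.eps_e hℓ hb'
  have h₂ := Path.wt_e hb'
  refine ⟨h₂, ?_, ?_⟩
  · change ((b'.eps i : ℤ) : WithBot ℤ) = ((b.eps i : ℤ) : WithBot ℤ) + _
    rw [h₁, ← WithBot.coe_add]
    rfl
  · change ((b'.eps i + b'.wt.1 i : ℤ) : WithBot ℤ) = ((b.eps i + b.wt.1 i : ℤ) : WithBot ℤ) + _
    rw [h₁, h₂, ← WithBot.coe_add, Prod.fst_add, Pi.add_apply, Path.simpleRoot_self hℓ]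
    congr 1
    ring

theorem coe_eq_add_of_eq_add {x y : WithBot ℤ} {n : ℤ} (h : x = y + (n : WithBot ℤ)) :
    y = x + ((-n : ℤ) : WithBot ℤ) := by
  rw [h, add_assoc, ← WithBot.coe_add, add_neg_cancel, WithBot.coe_zero, add_zero]

theorem pathCrystal_isCrystal {ℓ : ℕ} (hℓ : 1 ≤ ℓ) :
    (pathCrystal ℓ).IsCrystal (affineDatum ℓ) where
  phi_eq i x := by
    obtain ⟨b, rfl⟩ := Quot.exists_rep x
    rfl
  wt_e i x y h := (pathCrystal_of_e hℓ h).1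
  eps_e i x y h := (pathCrystal_of_e hℓ h).2.1
  phi_e i x y h := (pathCrystal_of_e hℓ h).2.2
  wt_f i x y h := by
    rw [(pathCrystal_of_e hℓ ((pathCrystal_inverse hℓ i y x).2 h)).1]
    exact (add_sub_cancel_right _ _).symm
  eps_f i x y h :=
    coe_eq_add_of_eq_add (pathCrystal_of_e hℓ ((pathCrystal_inverse hℓ i y x).2 h)).2.1
  phi_f i x y h :=
    coe_eq_add_of_eq_add (pathCrystal_of_e hℓ ((pathCrystal_inverse hℓ i y x).2 h)).2.2
  inverse := pathCrystal_inverse hℓ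
  phi_bot i x h := by
    obtain ⟨b, rfl⟩ := Quot.exists_rep x
    exact (WithBot.coe_ne_bot h).elim

theorem pathCrystal_isNormal {ℓ : ℕ} (hℓ : 1 ≤ ℓ) : (pathCrystal ℓ).IsNormal := by
  have hε : ∀ i x, ∃ n : ℕ, (pathCrystal ℓ).ε i x = ((n : ℤ) : WithBot ℤ) ∧
      ((pathCrystal ℓ).e i x = none ↔ n = 0) := by
    intro i x
    obtain ⟨b, rfl⟩ := Quot.exists_rep x
    obtain ⟨n, hn⟩ := Int.eq_ofNat_of_zero_le (b.eps_nonneg i)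
    refine ⟨n, congrArg _ hn, Option.map_eq_none_iff.trans (Path.e_eq_none_iff.trans ?_)⟩
    omega
  have hφ : ∀ i x, ∃ n : ℕ, (pathCrystal ℓ).φ i x = ((n : ℤ) : WithBot ℤ) ∧
      ((pathCrystal ℓ).f i x = none ↔ n = 0) := by
    intro i x
    obtain ⟨b, rfl⟩ := Quot.exists_rep x
    obtain ⟨n, hn⟩ := Int.eq_ofNat_of_zero_le (b.phi_nonneg i)
    refine ⟨n, congrArg _ hn, Option.map_eq_none_iff.trans (Path.f_eq_none_iff.trans ?_)⟩
    omega
  choose N₁ hε he using hε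
  choose N₂ hφ hf using hφ
  exact CrystalOps.isNormal_of_nat (pathCrystal_isCrystal hℓ) hε hφ he hf

/-! ### Ascents of a word and the numbers `κ_s` -/

section Words

variable {ℓ m : ℕ}

/-- The letter of `b` at the place `s`, counted from the left and starting with `0`, as a natural
number; it is `0` if there is no such place. -/
def entry (b : Fin m → Fin (ℓ + 1)) (s : ℕ) : ℕ := if h : s < m then (b ⟨s, h⟩ : ℕ) else 0

theorem entry_of_lt (b : Fin m → Fin (ℓ + 1)) (j : Fin m) : entry b j = b j :=
  dif_pos j.2

theorem card_desc_filter (b : Fin m → Fin (ℓ + 1)) {t : ℕ} (ht : t < m) :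
    ((desc b).filter (· < m - t)).card =
      ((Finset.Ico t (m - 1)).filter fun s => entry b s < entry b (s + 1)).card := by
  refine Finset.card_nbij' (fun r => m - 1 - r) (fun s => m - 1 - s) ?_ ?_ ?_ ?_
  · intro r hr
    simp only [desc, Finset.coe_filter, Finset.mem_filter, Finset.mem_Ico,
      Set.mem_ofPred_eq] at hr ⊢
    refine ⟨by omega, ?_⟩
    rw [show m - 1 - r = m - (r + 1) by omega, show m - (r + 1) + 1 = m - r by omega]
    exact hr.1.2
  · intro s hs
    simp only [desc, Finset.coe_filter, Finset.mem_filter, Finset.mem_Ico,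
      Set.mem_ofPred_eq] at hs ⊢
    refine ⟨⟨by omega, ?_⟩, by omega⟩
    change entry b (m - (m - 1 - s + 1)) < entry b (m - (m - 1 - s))
    rw [show m - (m - 1 - s + 1) = s by omega, show m - (m - 1 - s) = s + 1 by omega]
    exact hs.2
  · intro r hr
    simp only [desc, Finset.coe_filter, Finset.mem_filter, Finset.mem_Ico,
      Set.mem_ofPred_eq] at hr
    change m - 1 - (m - 1 - r) = r
    omega
  · intro s hs
    simp only [Finset.coe_filter, Finset.mem_Ico, Set.mem_ofPred_eq] at hs
    change m - 1 - (m - 1 - s) = s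
    omega

/-- `ρ_{t+1}(b) - 1` is the number of ascents of `b`, read from the left, at places that are not
before `t`. -/
theorem rho_succ (b : Fin m → Fin (ℓ + 1)) {t : ℕ} (ht : t < m) :
    rho b (t + 1) =
      ((Finset.Ico t (m - 1)).filter fun s => entry b s < entry b (s + 1)).card + 1 := by
  have hm : 0 < m := by omega
  rw [← card_desc_filter b ht]
  set d := ((desc b).filter (· < m - t)).card with hd
  have hdb : d + 1 ≤ blocks b := Nat.succ_le_succ (Finset.card_filter_le _ _)
  have hcount : Nat.count (· ∈ majSet b) (m - t) = d + 1 := by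
    have : (Finset.range (m - t)).filter (· ∈ majSet b) =
        insert 0 ((desc b).filter (· < m - t)) := by
      ext x
      have hx : x ∈ desc b → 0 < x ∧ x < m := mem_desc b
      simp only [majSet, Finset.mem_filter, Finset.mem_range, Finset.mem_insert]
      constructor
      · rintro ⟨h, h' | h' | h'⟩
        · exact Or.inl h'
        · omega
        · exact Or.inr ⟨h', h⟩
      · rintro (h | ⟨h, h'⟩)
        · exact ⟨by omega, Or.inl h⟩
        · exact ⟨h', Or.inr (Or.inr h)⟩
    rw [Nat.count_eq_card_filter_range, this, Finset.card_insert_of_notMem, hd]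
    exact fun h => lt_irrefl _ (mem_desc b (Finset.mem_filter.1 h).1).1
  refine rho_eq b hm (by omega) hdb ?_ ?_
  · rw [show m - (t + 1) + 1 = m - t by omega]
    exact Nat.nth_lt_of_lt_count (by omega)
  · rw [show m - (t + 1) + 1 = m - t by omega]
    by_contra! hlt
    have hcard : ∀ hf : {x | x ∈ majSet b}.Finite, d + 1 < hf.toFinset.card := fun hf => by
      have hc : hf.toFinset = majSet b := by ext x; simp
      rw [hc, card_majSet b hm]
      omega
    have h₁ : Nat.count (· ∈ majSet b) (cut b (d + 1) + 1) = d + 1 + 1 := by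
      have hmem : cut b (d + 1) ∈ majSet b := Nat.nth_mem (p := (· ∈ majSet b)) _ hcard
      rw [Nat.count_succ, if_pos hmem]
      exact congrArg (· + 1) (Nat.count_nth hcard)
    have h₂ := Nat.count_monotone (· ∈ majSet b) (show cut b (d + 1) + 1 ≤ m - t from hlt)
    omega

theorem coe_sub_one_lt_iff {i c : Fin (ℓ + 1)} (hc : c ≠ i) :
    ((i - 1 : Fin (ℓ + 1)) : ℕ) < c ↔ (i : ℕ) < c ∧ i ≠ 0 := by
  have := c.2
  have h₁ : (c : ℕ) ≠ i := fun h => hc (Fin.ext h)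
  rw [Fin.coe_sub_one]
  split_ifs with h
  · simp only [h, ne_eq, not_true_eq_false, and_false, iff_false]
    omega
  · have : (i : ℕ) ≠ 0 := fun h' => h (Fin.ext h')
    simp only [ne_eq, h, not_false_eq_true, and_true]
    omega

theorem lt_coe_sub_one_iff {i c : Fin (ℓ + 1)} (hc : c ≠ i - 1) :
    (c : ℕ) < (i - 1 : Fin (ℓ + 1)) ↔ (c : ℕ) < i ∨ i = 0 := by
  have := c.2
  have h₁ : (c : ℕ) ≠ (i - 1 : Fin (ℓ + 1)) := fun h => hc (Fin.ext h)
  rw [Fin.coe_sub_one] at h₁ ⊢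
  split_ifs at h₁ ⊢ with h
  · simp only [h, or_true, iff_true]
    omega
  · have : (i : ℕ) ≠ 0 := fun h' => h (Fin.ext h')
    simp only [h, or_false]
    omega

/-- `δ_{i,0}`. -/
def delta (i : Fin (ℓ + 1)) : ℤ := if i = 0 then 1 else 0

variable {b : Fin m → Fin (ℓ + 1)} {k : Fin m} {i : Fin (ℓ + 1)}

/-- Replacing a letter `i` by `i - 1` changes the set of ascents only if `i = 0`, provided that the
letter before it is not `i - 1` and the letter after it is not `i`. For `i = 0` the ascent from the
place `k` to the next one is lost and one from the place before `k` to `k` is gained, as far as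
these neighbours exist. -/
theorem ascent_update (hk : b k = i) (hprev : ∀ j : Fin m, (j : ℕ) + 1 = k → b j ≠ i - 1)
    (hnext : ∀ j : Fin m, (k : ℕ) + 1 = j → b j ≠ i) {s : ℕ} (hs : s + 1 < m) :
    (if entry (Function.update b k (i - 1)) s < entry (Function.update b k (i - 1)) (s + 1)
      then (1 : ℤ) else 0) =
    (if entry b s < entry b (s + 1) then (1 : ℤ) else 0) +
      ((if s + 1 = k then delta i else 0) - if s = k then delta i else 0) := by
  obtain ⟨x, rfl⟩ : ∃ x : Fin m, (x : ℕ) = s := ⟨⟨s, by omega⟩, rfl⟩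
  obtain ⟨y, hy⟩ : ∃ y : Fin m, (y : ℕ) = x + 1 := ⟨⟨x + 1, hs⟩, rfl⟩
  simp only [← hy, entry_of_lt]
  have hxy : x ≠ y := fun h => by rw [h] at hy; omega
  by_cases h₁ : y = k
  · subst h₁
    have hc := hprev x hy.symm
    have hxy' : (x : ℕ) ≠ y := fun h => hxy (Fin.ext h)
    rw [Function.update_of_ne hxy, Function.update_self, hk, if_pos rfl, if_neg hxy', sub_zero,
      delta]
    simp only [lt_coe_sub_one_iff hc]
    by_cases hi : i = 0
    · simp [hi]
    · simp [hi]
  by_cases h₂ : x = k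
  · subst h₂
    have hc := hnext y hy.symm
    have hxy' : (y : ℕ) ≠ x := fun h => hxy (Fin.ext h.symm)
    rw [Function.update_of_ne hxy.symm, Function.update_self, hk, if_pos rfl, if_neg hxy',
      zero_sub, delta]
    simp only [coe_sub_one_lt_iff hc]
    by_cases hi : i = 0
    · have hpos : 0 < (b y : ℕ) := Nat.pos_of_ne_zero fun h => hc (Fin.ext (by simp [h, hi]))
      simp [hi, hpos]
    · simp [hi]
  · have h₁' : (y : ℕ) ≠ k := fun h => h₁ (Fin.ext h)
    have h₂' : (x : ℕ) ≠ k := fun h => h₂ (Fin.ext h)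
    rw [Function.update_of_ne h₁, Function.update_of_ne h₂, if_neg h₁', if_neg h₂', sub_zero,
      add_zero]

theorem rho_update (hk : b k = i) (hprev : ∀ j : Fin m, (j : ℕ) + 1 = k → b j ≠ i - 1)
    (hnext : ∀ j : Fin m, (k : ℕ) + 1 = j → b j ≠ i) {t : ℕ} (ht : t < m) :
    (rho (Function.update b k (i - 1)) (t + 1) : ℤ) = rho b (t + 1) +
      ((if m - 1 = k then delta i else 0) - if t = k then delta i else 0) := by
  rw [rho_succ _ ht, rho_succ _ ht, Nat.cast_succ, Nat.cast_succ, Finset.natCast_card_filter,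
    Finset.natCast_card_filter, ← Finset.sum_Ico_sub (fun s : ℕ => if s = k then delta i else 0)
      (show t ≤ m - 1 by omega), add_right_comm, ← Finset.sum_add_distrib]
  congr 1
  refine Finset.sum_congr rfl fun s hs => ?_
  rw [Finset.mem_Ico] at hs
  exact ascent_update hk hprev hnext (by omega)

theorem kappa_update (hk : b k = i) (hprev : ∀ j : Fin m, (j : ℕ) + 1 = k → b j ≠ i - 1)
    (hnext : ∀ j : Fin m, (k : ℕ) + 1 = j → b j ≠ i) (n : ℤ) {s : ℕ} (hs : s ≤ m) :
    kappa (Function.update b k (i - 1)) (n + delta i) s =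
      kappa b n s + if (k : ℕ) < s then (delta i : ℚ) else 0 := by
  have hm : 0 < m := k.pos
  have hm' : (m : ℚ) ≠ 0 := by exact_mod_cast hm.ne'
  have hsum : ∀ s ≤ m, ∑ t ∈ Finset.range s, (rho (Function.update b k (i - 1)) (t + 1) : ℤ) =
      ∑ t ∈ Finset.range s, (rho b (t + 1) : ℤ) +
        (s * (if m - 1 = k then delta i else 0) - if (k : ℕ) < s then delta i else 0) := by
    intro s hs
    rw [Finset.sum_congr rfl fun t ht => rho_update hk hprev hnext
        ((Finset.mem_range.1 ht).trans_le hs), Finset.sum_add_distrib, Finset.sum_sub_distrib,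
      Finset.sum_const, Finset.card_range, nsmul_eq_mul, Finset.sum_ite_eq']
    simp only [Finset.mem_range]
  have hN := hsum m le_rfl
  rw [sum_rho _ hm, sum_rho _ hm, if_pos k.2] at hN
  have hsum' : ∑ t ∈ Finset.range s, (rho (Function.update b k (i - 1)) (t + 1) : ℚ) =
      ∑ t ∈ Finset.range s, (rho b (t + 1) : ℚ) +
        (s * (if m - 1 = k then (delta i : ℚ) else 0) -
          if (k : ℕ) < s then (delta i : ℚ) else 0) := by
    exact_mod_cast hsum s hs
  have hN' : (bigN (Function.update b k (i - 1)) : ℚ) = bigN b +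
      (m * (if m - 1 = k then (delta i : ℚ) else 0) - delta i) := by
    exact_mod_cast hN
  rw [kappa_eq, kappa_eq, hsum', hN']
  push_cast
  field_simp
  ring

theorem wt_sub_one (i : Fin (ℓ + 1)) : (Bl ℓ).wt (i - 1) = (Bl ℓ).wt i + (simpleRoot i).1 := by
  simp only [Bl, simpleRoot, sub_add_cancel]
  abel

theorem lamSeq_update (hk : b k = i) (hprev : ∀ j : Fin m, (j : ℕ) + 1 = k → b j ≠ i - 1)
    (hnext : ∀ j : Fin m, (k : ℕ) + 1 = j → b j ≠ i) (n : ℤ) {s : ℕ} (hs : s ≤ m) :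
    lamSeq (Function.update b k (i - 1)) (n + delta i) s =
      lamSeq b n s + if (k : ℕ) < s then toQP (simpleRoot i) else 0 := by
  have hwt : ∀ j, (Bl ℓ).wt (Function.update b k (i - 1) j) =
      (Bl ℓ).wt (b j) + if j = k then (simpleRoot i).1 else 0 := by
    intro j
    by_cases h : j = k
    · subst h
      rw [Function.update_self, if_pos rfl, wt_sub_one, hk]
    · rw [Function.update_of_ne h, if_neg h, add_zero]
  have hsum : ∑ j ∈ Finset.univ.filter (fun j : Fin m => (j : ℕ) < s),
        (Bl ℓ).wt (Function.update b k (i - 1) j) =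
      ∑ j ∈ Finset.univ.filter (fun j : Fin m => (j : ℕ) < s), (Bl ℓ).wt (b j) +
        if (k : ℕ) < s then (simpleRoot i).1 else 0 := by
    simp only [hwt, Finset.sum_add_distrib, Finset.sum_ite_eq', Finset.mem_filter,
      Finset.mem_univ, true_and]
  rw [lamSeq, lamSeq, hsum, kappa_update hk hprev hnext n hs]
  split_ifs with h
  · ext j
    · simp [toQP]
    · simp [toQP, simpleRoot, delta]
  · simp

end Words

/-! ### Broken lines and bending -/

section Broken

variable {ℓ m : ℕ}

/-- The time `s / m`. -/
def node {s : ℕ} (hs : s ≤ m) : UnitQ :=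
  ⟨s / m, by positivity, div_le_one_of_le₀ (by exact_mod_cast hs) (Nat.cast_nonneg m)⟩

theorem mul_node (hm : 0 < m) {s : ℕ} (hs : s ≤ m) : (m : ℚ) * (node hs : UnitQ) = s :=
  mul_div_cancel₀ _ (by exact_mod_cast hm.ne')

theorem le_node_iff (hm : 0 < m) {s : ℕ} (hs : s ≤ m) {τ : UnitQ} :
    τ ≤ node hs ↔ (m : ℚ) * τ ≤ s := by
  rw [← mul_node hm hs, mul_le_mul_iff_of_pos_left (by exact_mod_cast hm)]
  rfl

theorem node_le_iff (hm : 0 < m) {s : ℕ} (hs : s ≤ m) {τ : UnitQ} :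
    node hs ≤ τ ↔ (s : ℚ) ≤ m * τ := by
  rw [← mul_node hm hs, mul_le_mul_iff_of_pos_left (by exact_mod_cast hm)]
  rfl

theorem node_self (hm : 0 < m) : node (le_refl m) = 1 :=
  Subtype.ext (div_self (by exact_mod_cast hm.ne'))

theorem mul_le_of_unit (τ : UnitQ) : (m : ℚ) * τ ≤ m :=
  mul_le_of_le_one_right (Nat.cast_nonneg m) τ.2.2

theorem exists_segment_lt (m : ℕ) (τ : UnitQ) : ∃ s : ℕ, (s : ℚ) ≤ m * τ ∧ (m : ℚ) * τ < s + 1 :=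
  ⟨⌊(m : ℚ) * τ⌋₊, Nat.floor_le (mul_nonneg (Nat.cast_nonneg m) τ.2.1), Nat.lt_floor_add_one _⟩

theorem exists_segment_le {τ : UnitQ} (h : (0 : ℚ) < m * τ) :
    ∃ s < m, (s : ℚ) < m * τ ∧ (m : ℚ) * τ ≤ s + 1 := by
  have h₁ : 0 < ⌈(m : ℚ) * τ⌉₊ := Nat.ceil_pos.2 h
  have h₂ : ⌈(m : ℚ) * τ⌉₊ ≤ m := Nat.ceil_le.2 (mul_le_of_unit τ)
  refine ⟨⌈(m : ℚ) * τ⌉₊ - 1, by omega, Nat.lt_ceil.1 (by omega), ?_⟩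
  have h₃ := Nat.le_ceil ((m : ℚ) * τ)
  rwa [Nat.cast_sub h₁, Nat.cast_one, sub_add_cancel]

theorem exists_segment (hm : 0 < m) (τ : UnitQ) :
    ∃ s < m, (s : ℚ) ≤ m * τ ∧ (m : ℚ) * τ ≤ s + 1 := by
  rcases (mul_nonneg (Nat.cast_nonneg m) τ.2.1 : (0 : ℚ) ≤ m * τ).eq_or_lt with h | h
  · exact ⟨0, hm, by simp [← h], by simp [← h]⟩
  · obtain ⟨s, h₁, h₂, h₃⟩ := exists_segment_le h
    exact ⟨s, h₁, h₂.le, h₃⟩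

theorem brokenFun_node (hm : 0 < m) (lam : ℕ → QP ℓ) {s : ℕ} (hs : s ≤ m) :
    brokenFun m lam (node hs) = lam s := by
  rw [brokenFun_eq (s := s) lam (mul_node hm hs).ge (by rw [mul_node hm hs]; linarith),
    mul_node hm hs, sub_self, zero_smul, add_zero]

theorem reflection_smul (i : Fin (ℓ + 1)) (c : ℚ) (v : QP ℓ) :
    Path.reflection i (c • v) = c • Path.reflection i v := by
  simp only [Path.reflection, Prod.smul_fst, Pi.smul_apply, smul_eq_mul]
  module

/-- Bending a broken line along the segment from `λ_k` to `λ_{k+1}` adds `γ` to all later vertices,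
if the reflection adds `γ` to this segment. -/
theorem bendFun_broken {b : Path ℓ} {lam lam' : ℕ → QP ℓ} (hb : b.toFun = brokenFun m lam) {k : ℕ}
    (hk : k < m) {i : Fin (ℓ + 1)} {γ : P ℓ}
    (hlam : ∀ s ≤ m, lam' s = lam s + if k < s then toQP γ else 0)
    (hrefl : Path.reflection i (lam (k + 1) - lam k) = lam (k + 1) - lam k + toQP γ) (τ : UnitQ) :
    b.bendFun i (node hk.le) (node hk) γ τ = brokenFun m lam' τ := by
  have hm : 0 < m := by omega
  obtain ⟨s, hs, h₁, h₂⟩ := exists_segment hm τ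
  have hbq : b.toFun (node hk.le) = lam k := by rw [hb, brokenFun_node hm]
  have hbp : b.toFun (node hk) = lam (k + 1) := by rw [hb, brokenFun_node hm]
  have hbτ : b.toFun τ = lam s + ((m : ℚ) * τ - s) • (lam (s + 1) - lam s) := by
    rw [hb, brokenFun_eq lam h₁ h₂]
  rw [brokenFun_eq lam' h₁ h₂, hlam s hs.le, hlam (s + 1) hs]
  rcases lt_trichotomy s k with h | rfl | h
  · have h₃ : (s + 1 : ℚ) ≤ k := by exact_mod_cast h
    rw [Path.bendFun_left ((le_node_iff hm _).2 (h₂.trans h₃)), hbτ, if_neg (by omega),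
      if_neg (by omega), add_zero, add_zero]
  · rw [Path.bendFun_mid ((node_le_iff hm _).2 h₁)
      ((le_node_iff hm _).2 (by push_cast; exact h₂)), hbτ, hbq, if_neg (lt_irrefl s),
      if_pos (Nat.lt_succ_self s), add_sub_cancel_left, reflection_smul, hrefl]
    module
  · have h₃ : ((k + 1 : ℕ) : ℚ) ≤ s := by exact_mod_cast h
    rw [Path.bendFun_right ((le_node_iff hm _).2 (by rw [mul_node hm]; push_cast; linarith))
      (by rw [hbq, hbp, hrefl]; abel) ((node_le_iff hm _).2 (h₃.trans h₁)), hbτ, if_pos h,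
      if_pos (by omega)]
    module

end Broken

/-! ### Heights of a word -/

section Heights

variable {ℓ m : ℕ} (b : Fin m → Fin (ℓ + 1)) (i : Fin (ℓ + 1))

/-- The value of `h^i` at the vertex `λ_s` of the path that belongs to `b`. -/
def height (s : ℕ) : ℤ :=
  -∑ j ∈ Finset.univ.filter (fun j : Fin m => (j : ℕ) < s), (Bl ℓ).wt (b j) i

theorem height_zero : height b i 0 = 0 := by simp [height]

theorem wt_apply (i j : Fin (ℓ + 1)) :
    (Bl ℓ).wt j i = (if j = i - 1 then 1 else 0) - if j = i then 1 else 0 := by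
  simp only [Bl, Lam, Pi.sub_apply, Pi.single_apply, eq_sub_iff_add_eq, eq_comm (a := i)]

theorem height_succ (k : Fin m) : height b i (k + 1) =
    height b i k + (if b k = i then 1 else 0) - if b k = i - 1 then 1 else 0 := by
  have : Finset.univ.filter (fun j : Fin m => (j : ℕ) < k + 1) =
      insert k (Finset.univ.filter fun j : Fin m => (j : ℕ) < k) := by
    ext j
    simp only [Finset.mem_filter, Finset.mem_univ, true_and, Finset.mem_insert, Fin.ext_iff]
    omega
  rw [height, this, Finset.sum_insert (by simp), wt_apply, height]
  ring

theorem kashiwara_eq (hℓ : 1 ≤ ℓ) (k : Fin m) :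
    CrystalOps.kashiwara (Bl ℓ) (finiteDatum ℓ) m i b k =
      ((max (height b i k) (height b i (k + 1)) : ℤ) : WithBot ℤ) := by
  have h : CrystalOps.kashiwara (Bl ℓ) (finiteDatum ℓ) m i b k =
      (((if i = b k then 1 else 0) + height b i k : ℤ) : WithBot ℤ) := by
    rw [WithBot.coe_add]
    simp only [CrystalOps.kashiwara, Bl]
    congr 1
    split_ifs <;> rfl
  have := ne_sub_one i hℓ
  rw [h, height_succ b i]
  congr 1
  by_cases h₁ : b k = i
  · simp [h₁, this, add_comm]
  · by_cases h₂ : b k = i - 1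
    · simp only [h₂, if_neg this, if_neg this.symm, if_true]
      omega
    · simp [h₁, h₂, eq_comm (a := i)]

/-- The function `ε_i` on `B_ℓ(m)` is the maximal height, and `maxPlaces` are the places of the
segments that reach this height. -/
theorem exists_max (hℓ : 1 ≤ ℓ) (hm : 0 < m) : ∃ M : ℤ, (Blm ℓ m).ε i b = (M : WithBot ℤ) ∧
    (∀ s ≤ m, height b i s ≤ M) ∧ (∃ s, ∃ _ : s ≤ m, height b i s = M) ∧
    (CrystalOps.maxPlaces (Bl ℓ) (finiteDatum ℓ) m i b).Nonempty ∧
    ∀ k, k ∈ CrystalOps.maxPlaces (Bl ℓ) (finiteDatum ℓ) m i b ↔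
      max (height b i k) (height b i (k + 1)) = M := by
  have hne : (Finset.univ : Finset (Fin m)).Nonempty := ⟨⟨0, hm⟩, Finset.mem_univ _⟩
  obtain ⟨k, -, hk⟩ := Finset.exists_mem_eq_sup _ hne
    (CrystalOps.kashiwara (Bl ℓ) (finiteDatum ℓ) m i b)
  have hle : ∀ j : Fin m, max (height b i j) (height b i (j + 1)) ≤
      max (height b i k) (height b i (k + 1)) := fun j => by
    have h := Finset.le_sup (f := CrystalOps.kashiwara (Bl ℓ) (finiteDatum ℓ) m i b)
      (Finset.mem_univ j)
    rwa [hk, kashiwara_eq b i hℓ, kashiwara_eq b i hℓ, WithBot.coe_le_coe] at h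
  rw [kashiwara_eq b i hℓ] at hk
  have hmem : ∀ j, j ∈ CrystalOps.maxPlaces (Bl ℓ) (finiteDatum ℓ) m i b ↔
      max (height b i j) (height b i (j + 1)) = max (height b i k) (height b i (k + 1)) :=
    fun j => by
      rw [CrystalOps.maxPlaces, Finset.mem_filter, hk, kashiwara_eq b i hℓ, WithBot.coe_inj]
      simp
  refine ⟨_, hk, fun s hs => ?_, ?_, ⟨k, (hmem k).2 rfl⟩, hmem⟩
  · rcases hs.eq_or_lt with rfl | h
    · refine le_trans ?_ (hle ⟨s - 1, by omega⟩)
      simp only [show s - 1 + 1 = s by omega]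
      exact le_max_right _ _
    · exact le_trans (le_max_left _ _) (hle ⟨s, h⟩)
  · rcases max_choice (height b i k) (height b i (k + 1)) with h | h
    · exact ⟨k, k.2.le, h.symm⟩
    · exact ⟨k + 1, k.2, h.symm⟩

theorem lamSeq_fst (n : ℤ) (s : ℕ) : (lamSeq b n s).1 i = -(height b i s : ℚ) := by
  simp [lamSeq, toQP, height]

end Heights

/-! ### The paths `ψ(b ⊗ z^n)` -/

section PsiPath

variable {ℓ m : ℕ} (hm : 0 < m) (b : Fin m → Fin (ℓ + 1)) (n : ℤ)

/-- The broken line that represents `ψ(b ⊗ z^n)`. -/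
noncomputable def psiPath : Path ℓ :=
  brokenPath m (lamSeq b n) ((BHat ℓ m).wt (b, n)) (lamSeq_zero b n) (lamSeq_last b hm n)

theorem toFun_psiPath : (psiPath hm b n).toFun = brokenFun m (lamSeq b n) := rfl

theorem wt_psiPath : (psiPath hm b n).wt = (BHat ℓ m).wt (b, n) := rfl

variable {hm b n} {i : Fin (ℓ + 1)}

theorem h_psiPath {τ : UnitQ} {s : ℕ} (h₁ : (s : ℚ) ≤ m * τ) (h₂ : (m : ℚ) * τ ≤ s + 1) :
    (psiPath hm b n).h i τ =
      height b i s + ((m : ℚ) * τ - s) * (height b i (s + 1) - height b i s) := by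
  rw [Path.h, toFun_psiPath, brokenFun_eq _ h₁ h₂]
  simp only [Prod.fst_add, Prod.smul_fst, Prod.fst_sub, Pi.add_apply, Pi.smul_apply, Pi.sub_apply,
    lamSeq_fst, smul_eq_mul]
  ring

theorem h_psiPath_node {s : ℕ} (hs : s ≤ m) : (psiPath hm b n).h i (node hs) = height b i s := by
  rw [Path.h, toFun_psiPath, brokenFun_node hm, lamSeq_fst, neg_neg]

theorem height_last (hm : 0 < m) : height b i m = -((BHat ℓ m).wt (b, n)).1 i := by
  have h := (psiPath hm b n).h_one i
  rw [← node_self hm, h_psiPath_node, wt_psiPath] at h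
  exact_mod_cast h

variable {M : ℤ}

theorem h_psiPath_le (hle : ∀ s ≤ m, height b i s ≤ M) (τ : UnitQ) :
    (psiPath hm b n).h i τ ≤ M := by
  obtain ⟨s, hs, h₁, h₂⟩ := exists_segment hm τ
  have h₃ : (height b i s : ℚ) ≤ M := by exact_mod_cast hle s hs.le
  have h₄ : (height b i (s + 1) : ℚ) ≤ M := by exact_mod_cast hle (s + 1) hs
  rw [h_psiPath h₁ h₂]
  nlinarith

theorem isGreatest_h_psiPath (hle : ∀ s ≤ m, height b i s ≤ M)
    (hex : ∃ s, ∃ _ : s ≤ m, height b i s = M) :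
    IsGreatest (Set.range ((psiPath hm b n).h i)) (M : ℚ) := by
  obtain ⟨s, hs, hM⟩ := hex
  refine ⟨⟨node hs, by rw [h_psiPath_node, hM]⟩, ?_⟩
  rintro _ ⟨τ, rfl⟩
  exact h_psiPath_le hle τ

theorem eps_psiPath (hle : ∀ s ≤ m, height b i s ≤ M)
    (hex : ∃ s, ∃ _ : s ≤ m, height b i s = M) : (psiPath hm b n).eps i = M := by
  obtain ⟨⟨τ, hτ⟩, hub⟩ := isGreatest_h_psiPath (hm := hm) (n := n) hle hex
  refine Path.eps_eq ⟨⟨τ, hτ⟩, fun N ⟨σ, hσ⟩ => ?_⟩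
  have := hub ⟨σ, hσ⟩
  exact_mod_cast this

/-- If the maximal height is reached for the first time at the end of an ascending segment, the path
is raised along this segment. -/
theorem isRaising_psiPath (heps : (psiPath hm b n).eps i = M) (hle : ∀ s ≤ m, height b i s ≤ M)
    {k : ℕ} (hk : k < m) (hM : height b i (k + 1) = M) (hM' : height b i k = M - 1)
    (hlt : ∀ s ≤ k, height b i s < M) :
    (psiPath hm b n).IsRaising i (node hk.le) (node hk) := by
  have hM'' : (height b i k : ℚ) = M - 1 := by rw [hM']; push_cast; rfl
  refine ⟨⟨?_, fun τ hτ => ?_⟩, fun h => ?_, ⟨?_, ?_⟩, ?_⟩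
  · rw [Set.mem_ofPred_eq, h_psiPath_node, hM, heps]
  · rw [Set.mem_ofPred_eq, heps] at hτ
    by_contra hcon
    rw [node_le_iff hm, not_le] at hcon
    obtain ⟨s, h₁, h₂⟩ := exists_segment_lt m τ
    have hsk : s < k + 1 := by exact_mod_cast h₁.trans_lt hcon
    have h₃ : (height b i s : ℚ) < M := by exact_mod_cast hlt s (by omega)
    have h₄ : (height b i (s + 1) : ℚ) ≤ M := by exact_mod_cast hle (s + 1) (by omega)
    rw [h_psiPath h₁ h₂.le] at hτ
    nlinarith
  · have := mul_node hm hk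
    rw [h] at this
    simp only [Set.Icc.coe_zero, mul_zero] at this
    norm_cast at this
  · rw [le_node_iff hm, mul_node hm]
    push_cast
    linarith
  · rw [h_psiPath_node, heps, hM'']
  · rintro τ ⟨hτ, hτ'⟩
    by_contra hcon
    rw [le_node_iff hm, not_le] at hcon
    rw [le_node_iff hm] at hτ
    push_cast at hτ
    rw [h_psiPath hcon.le hτ, heps, hM, hM''] at hτ'
    linarith

/-- If the maximal height is reached for the last time at the start of a descending segment, the
path is lowered along this segment. -/
theorem isLowering_psiPath (heps : (psiPath hm b n).eps i = M) (hle : ∀ s ≤ m, height b i s ≤ M)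
    {k : ℕ} (hk : k < m) (hM : height b i k = M) (hM' : height b i (k + 1) = M - 1)
    (hlt : ∀ s ≤ m, k < s → height b i s < M) :
    (psiPath hm b n).IsLowering i (node hk.le) (node hk) := by
  have hM'' : (height b i (k + 1) : ℚ) = M - 1 := by rw [hM']; push_cast; rfl
  refine ⟨⟨?_, fun τ hτ => ?_⟩, fun h => ?_, ⟨?_, ?_⟩, ?_⟩
  · rw [Set.mem_ofPred_eq, h_psiPath_node, hM, heps]
  · rw [Set.mem_ofPred_eq, heps] at hτ
    by_contra hcon
    rw [le_node_iff hm, not_le] at hcon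
    obtain ⟨s, hsm, h₁, h₂⟩ := exists_segment_le ((Nat.cast_nonneg k).trans_lt hcon)
    have hks : k < s + 1 := by exact_mod_cast hcon.trans_le h₂
    have h₃ : (height b i s : ℚ) ≤ M := by exact_mod_cast hle s hsm.le
    have h₄ : (height b i (s + 1) : ℚ) < M := by exact_mod_cast hlt (s + 1) hsm hks
    rw [h_psiPath h₁.le h₂] at hτ
    nlinarith
  · have := mul_node hm hk.le
    rw [h] at this
    simp only [Set.Icc.coe_one, mul_one] at this
    norm_cast at this
    omega
  · rw [le_node_iff hm, mul_node hm]
    push_cast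
    linarith
  · rw [h_psiPath_node, heps, hM'']
  · rintro τ ⟨hτ, hτ'⟩
    by_contra hcon
    rw [node_le_iff hm, not_le] at hcon
    rw [node_le_iff hm] at hτ
    push_cast at hcon
    rw [h_psiPath hτ hcon.le, heps, hM, hM''] at hτ'
    linarith

end PsiPath

/-! ### Compatibility of `ψ` with the operators -/

section Psi

variable {ℓ m : ℕ} {b : Fin m → Fin (ℓ + 1)} {n : ℤ} {i : Fin (ℓ + 1)}

theorem BHat_e (h : (CrystalOps.maxPlaces (Bl ℓ) (finiteDatum ℓ) m i b).Nonempty) :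
    (BHat ℓ m).e i (b, n) = if i = b (Finset.min' _ h) then
      some (Function.update b (Finset.min' _ h) (i - 1), n + delta i) else none := by
  have hB : (Blm ℓ m).e i b = ((Bl ℓ).e i (b (Finset.min' _ h))).map
      (Function.update b (Finset.min' _ h)) := dif_pos h
  have he : (BHat ℓ m).e i (b, n) = ((Blm ℓ m).e i b).map fun b => (b, n + delta i) := rfl
  rw [he, hB]
  generalize Finset.min' _ h = k
  have hl : (Bl ℓ).e i (b k) = if i = b k then some (b k - 1) else none := rfl
  rw [hl]
  split_ifs with hi
  · rw [← hi]
    rfl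
  · rfl

theorem BHat_f (h : (CrystalOps.maxPlaces (Bl ℓ) (finiteDatum ℓ) m i b).Nonempty) :
    (BHat ℓ m).f i (b, n) = if i - 1 = b (Finset.max' _ h) then
      some (Function.update b (Finset.max' _ h) i, n - delta i) else none := by
  have hB : (Blm ℓ m).f i b = ((Bl ℓ).f i (b (Finset.max' _ h))).map
      (Function.update b (Finset.max' _ h)) := dif_pos h
  have hf : (BHat ℓ m).f i (b, n) = ((Blm ℓ m).f i b).map fun b => (b, n - delta i) := rfl
  rw [hf, hB]
  generalize Finset.max' _ h = k
  have hl : (Bl ℓ).f i (b k) = if i - 1 = b k then some i else none := rfl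
  rw [hl]
  split_ifs with hi
  · rfl
  · rfl

theorem reflection_segment {k : Fin m} {γ : P ℓ} {c : ℤ}
    (hc : height b i (k + 1) = height b i k + c) (hγ : toQP γ = (c : ℚ) • toQP (simpleRoot i)) :
    Path.reflection i (lamSeq b n (k + 1) - lamSeq b n k) =
      lamSeq b n (k + 1) - lamSeq b n k + toQP γ := by
  rw [Path.reflection, Prod.fst_sub, Pi.sub_apply, lamSeq_fst, lamSeq_fst, hc, hγ]
  push_cast
  module

/-- If `e_i` changes `b ⊗ z^n`, then it bends the path at the segment of the changed letter;
otherwise the heights of `b` are nowhere positive. -/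
theorem psiPath_e (hℓ : 1 ≤ ℓ) (hm : 0 < m) (b : Fin m → Fin (ℓ + 1)) (n : ℤ)
    (i : Fin (ℓ + 1)) :
    ((BHat ℓ m).e i (b, n)).map (fun x => psiPath hm x.1 x.2) = (psiPath hm b n).e i := by
  obtain ⟨M, -, hle, hex, hne, hmem⟩ := exists_max b i hℓ hm
  have heps : (psiPath hm b n).eps i = M := eps_psiPath hle hex
  have hi := ne_sub_one i hℓ
  rw [BHat_e hne]
  obtain ⟨k, hk⟩ : ∃ k, k = Finset.min' _ hne := ⟨_, rfl⟩
  have hkM := (hmem k).1 (hk ▸ Finset.min'_mem _ hne)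
  have hmin : ∀ j : Fin m, j < k → max (height b i j) (height b i (j + 1)) < M := fun j hj =>
    lt_of_le_of_ne (max_le (hle j j.2.le) (hle _ j.2)) fun h =>
      not_le.2 hj (hk ▸ Finset.min'_le _ j ((hmem j).2 h))
  rw [← hk]
  have hsucc := height_succ b i
  have hsk := hsucc k
  split_ifs with hik
  · rw [← hik, if_pos rfl, if_neg hi] at hsk
    have hM : height b i (k + 1) = M := by omega
    have hM' : height b i k = M - 1 := by omega
    have hlt : ∀ s ≤ (k : ℕ), height b i s < M := by
      intro s hs
      rcases hs.eq_or_lt with rfl | h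
      · omega
      · exact (le_max_left _ _).trans_lt (hmin ⟨s, h.trans k.2⟩ h)
    rw [Option.map_some]
    refine (Path.e_eq_some_iff.2
      ⟨_, _, isRaising_psiPath heps hle k.2 hM hM' hlt, Path.ext' fun τ => ?_⟩).symm
    refine (bendFun_broken (toFun_psiPath hm b n) k.2 (γ := simpleRoot i)
      (fun s hs => lamSeq_update hik.symm (fun j hj => ?_) (fun j hj => ?_) n hs)
      (reflection_segment (c := 1) (by omega) (by simp)) τ).symm
    · -- after a letter `i - 1` the segment `k` would start at the maximal height
      intro hj'
      have h := hsucc j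
      rw [hj', if_neg hi.symm, if_pos rfl, hj] at h
      have := hlt j (by omega)
      omega
    · -- a further letter `i` would exceed the maximal height
      intro hj'
      have h := hsucc j
      rw [hj', if_pos rfl, if_neg hi, ← hj] at h
      have := hle (k + 1 + 1) (hj ▸ j.2)
      omega
  · rw [Option.map_none, eq_comm, Path.e_eq_none_iff, heps]
    rw [if_neg (fun h => hik h.symm)] at hsk
    have hM : height b i k = M := by split_ifs at hsk <;> omega
    rcases Nat.eq_zero_or_pos (k : ℕ) with h0 | hpos
    · rw [← hM, h0, height_zero]
    · have := hmin ⟨k - 1, by omega⟩ (Nat.sub_lt hpos one_pos)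
      simp only [show (k : ℕ) - 1 + 1 = k by omega] at this
      omega

/-- If `f_i` changes `b ⊗ z^n`, then it bends the path at the segment of the changed letter;
otherwise the height of `b` is maximal at the end. -/
theorem psiPath_f (hℓ : 1 ≤ ℓ) (hm : 0 < m) (b : Fin m → Fin (ℓ + 1)) (n : ℤ)
    (i : Fin (ℓ + 1)) :
    ((BHat ℓ m).f i (b, n)).map (fun x => psiPath hm x.1 x.2) = (psiPath hm b n).f i := by
  obtain ⟨M, -, hle, hex, hne, hmem⟩ := exists_max b i hℓ hm
  have heps : (psiPath hm b n).eps i = M := eps_psiPath hle hex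
  have hi := ne_sub_one i hℓ
  rw [BHat_f hne]
  obtain ⟨k, hk⟩ : ∃ k, k = Finset.max' _ hne := ⟨_, rfl⟩
  have hkM := (hmem k).1 (hk ▸ Finset.max'_mem _ hne)
  have hmax : ∀ j : Fin m, k < j → max (height b i j) (height b i (j + 1)) < M := fun j hj =>
    lt_of_le_of_ne (max_le (hle j j.2.le) (hle _ j.2)) fun h =>
      not_le.2 hj (hk ▸ Finset.le_max' _ j ((hmem j).2 h))
  rw [← hk]
  have hsucc := height_succ b i
  have hsk := hsucc k
  split_ifs with hik
  · rw [← hik, if_neg hi.symm, if_pos rfl] at hsk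
    have hM : height b i k = M := by omega
    have hM' : height b i (k + 1) = M - 1 := by omega
    have hlt : ∀ s ≤ m, (k : ℕ) < s → height b i s < M := by
      intro s hs hks
      rcases (show (k : ℕ) + 1 ≤ s from hks).eq_or_lt with rfl | h
      · rw [hM']
        omega
      · have := (le_max_right _ _).trans_lt (hmax ⟨s - 1, by omega⟩ (Fin.lt_def.2 (by
          simp only
          omega)))
        simpa only [show s - 1 + 1 = s by omega] using this
    rw [Option.map_some]
    have hb : Function.update (Function.update b k i) k (i - 1) = b := by
      rw [Function.update_idem, hik, Function.update_eq_self]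
    refine (Path.f_eq_some_iff.2
      ⟨_, _, isLowering_psiPath heps hle k.2 hM hM' hlt, Path.ext' fun τ => ?_⟩).symm
    refine (bendFun_broken (toFun_psiPath hm b n) k.2 (γ := -simpleRoot i) (fun s hs => ?_)
      (reflection_segment (c := -1) (by omega) (by ext <;> simp [toQP])) τ).symm
    -- the word `b` arises from its image under `f_i` by replacing the letter `i` by `i - 1`
    have h := lamSeq_update (b := Function.update b k i) (k := k) (Function.update_self k i b)
      (fun j hj => ?_) (fun j hj => ?_) (n - delta i) hs
    · rw [hb, sub_add_cancel] at h
      rw [h, show toQP (-simpleRoot i) = -toQP (simpleRoot i) by ext <;> simp [toQP]]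
      split_ifs <;> simp
    · intro hj'
      rw [Function.update_of_ne (fun h => by rw [h] at hj; omega)] at hj'
      have h := hsucc j
      rw [hj', if_neg hi.symm, if_pos rfl, hj] at h
      have := hle j j.2.le
      omega
    · intro hj'
      rw [Function.update_of_ne (fun h => by rw [h] at hj; omega)] at hj'
      have h := hsucc j
      rw [hj', if_pos rfl, if_neg hi, ← hj] at h
      have := hlt (k + 1 + 1) (hj ▸ j.2) (by omega)
      omega
  · rw [Option.map_none, eq_comm, Path.f_eq_none_iff, heps, wt_psiPath,
      ← neg_eq_iff_eq_neg.2 (height_last (n := n) (i := i) (b := b) hm)]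
    rw [if_neg (fun h : b k = i - 1 => hik h.symm)] at hsk
    have hM : height b i (k + 1) = M := by split_ifs at hsk <;> omega
    rcases (show (k : ℕ) + 1 ≤ m from k.2).eq_or_lt with h | h
    · rw [← hM, h]
      ring
    · have := hmax ⟨k + 1, h⟩ (Fin.lt_def.2 (Nat.lt_succ_self _))
      simp only at this
      omega

/-! ### Injectivity of `ψ` -/

/-- The path passes through the points `v_0, …, v_m` in this order. -/
def Path.Visits (p : Path ℓ) (m : ℕ) (v : ℕ → QP ℓ) : Prop :=
  ∃ g : ℕ → UnitQ, Monotone g ∧ ∀ s ≤ m, p.toFun (g s) = v s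

theorem Path.visits_iff_of_reparam {p₁ p₂ : Path ℓ} (h : Reparam p₁ p₂) (v : ℕ → QP ℓ) :
    p₁.Visits m v ↔ p₂.Visits m v := by
  obtain ⟨θ, -, hmono, hsurj, hp⟩ := h
  constructor
  · rintro ⟨g, hg, hv⟩
    exact ⟨θ ∘ g, hmono.comp hg, fun s hs => by rw [Function.comp_apply, ← hp, hv s hs]⟩
  · rintro ⟨g, hg, hv⟩
    have hinv := Function.rightInverse_surjInv hsurj
    refine ⟨Function.surjInv hsurj ∘ g, fun s t hst => ?_, fun s hs => by
      rw [Function.comp_apply, hp, hinv, hv s hs]⟩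
    rcases (hg hst).eq_or_lt with h | h
    · exact le_of_eq (congrArg (Function.surjInv hsurj) h)
    · refine le_of_not_ge fun hle => not_le.2 h ?_
      have := hmono hle
      rwa [Function.comp_apply, Function.comp_apply, hinv, hinv] at this

/-- At a time where the path `ψ(b ⊗ z^n)` is integral in the directions `Λ_i`, it is at a vertex. -/
theorem exists_node_of_integral (hℓ : 1 ≤ ℓ) (hm : 0 < m) {τ : UnitQ}
    (hint : ∀ i, ∃ c : ℤ, (psiPath hm b n).h i τ = c) : ∃ s : ℕ, (m : ℚ) * τ = s := by
  obtain ⟨s, h₁, h₂⟩ := exists_segment_lt m τ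
  have hsm : s ≤ m := by exact_mod_cast h₁.trans (mul_le_of_unit τ)
  rcases hsm.eq_or_lt with rfl | hs
  · exact ⟨s, le_antisymm (mul_le_of_unit τ) h₁⟩
  obtain ⟨c, hc⟩ := hint (b ⟨s, hs⟩)
  have hH := height_succ b (b ⟨s, hs⟩) ⟨s, hs⟩
  rw [if_pos rfl, if_neg (ne_sub_one _ hℓ)] at hH
  simp only [sub_zero] at hH
  rw [h_psiPath h₁ h₂.le, hH] at hc
  push_cast at hc
  have h₃ : (m : ℚ) * τ - s = (c - height b (b ⟨s, hs⟩) s : ℤ) := by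
    push_cast
    linarith
  have h₄ : (0 : ℚ) ≤ (c - height b (b ⟨s, hs⟩) s : ℤ) := by rw [← h₃]; linarith
  have h₅ : ((c - height b (b ⟨s, hs⟩) s : ℤ) : ℚ) < 1 := by rw [← h₃]; linarith
  have h₆ : c - height b (b ⟨s, hs⟩) s = 0 := by
    have h₄' : 0 ≤ c - height b (b ⟨s, hs⟩) s := by exact_mod_cast h₄
    have h₅' : c - height b (b ⟨s, hs⟩) s < 1 := by exact_mod_cast h₅
    omega
  rw [h₆, Int.cast_zero] at h₃
  exact ⟨s, by linarith⟩

theorem eq_id_of_strictMono {t : ℕ → ℕ} (hlt : ∀ s < m, t s < t (s + 1)) (hle : ∀ s ≤ m, t s ≤ m)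
    {s : ℕ} (hs : s ≤ m) : t s = s := by
  have h₁ : ∀ s ≤ m, s ≤ t s := by
    intro s
    induction s with
    | zero => omega
    | succ s ih =>
      intro hs
      have := ih (by omega)
      have := hlt s (by omega)
      omega
  have h₂ : ∀ j ≤ m, t (m - j) + j ≤ m := by
    intro j
    induction j with
    | zero => intro _; exact hle m le_rfl
    | succ j ih =>
      intro hj
      have h₃ := ih (by omega)
      have h₄ := hlt (m - (j + 1)) (by omega)
      rw [show m - (j + 1) + 1 = m - j by omega] at h₄
      omega
  have h₃ := h₁ s hs
  have h₄ := h₂ (m - s) (by omega)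
  rw [show m - (m - s) = s by omega] at h₄
  omega

theorem lamSeq_eq_of_visits (hℓ : 1 ≤ ℓ) (hm : 0 < m) {b' : Fin m → Fin (ℓ + 1)} {n' : ℤ}
    (h : (psiPath hm b n).Visits m (lamSeq b' n')) {s : ℕ} (hs : s ≤ m) :
    lamSeq b n s = lamSeq b' n' s := by
  obtain ⟨g, hg, hv⟩ := h
  have hnode : ∀ s, ∃ t : ℕ, s ≤ m → (m : ℚ) * g s = t := by
    intro s
    by_cases hs : s ≤ m
    · obtain ⟨t, ht⟩ := exists_node_of_integral (b := b) (n := n) hℓ hm (τ := g s) fun i =>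
        ⟨height b' i s, by rw [Path.h, hv s hs, lamSeq_fst, neg_neg]⟩
      exact ⟨t, fun _ => ht⟩
    · exact ⟨0, fun h => (hs h).elim⟩
  choose t ht using hnode
  have htm : ∀ s ≤ m, t s ≤ m := fun s hs => by
    have := mul_le_of_unit (m := m) (g s)
    rw [ht s hs] at this
    exact_mod_cast this
  have hval : ∀ s ≤ m, lamSeq b n (t s) = lamSeq b' n' s := fun s hs => by
    rw [← hv s hs, toFun_psiPath,
      brokenFun_eq (s := t s) _ (ht s hs).ge (by rw [ht s hs]; linarith),
      ht s hs, sub_self, zero_smul, add_zero]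
  have hlt : ∀ s < m, t s < t (s + 1) := by
    intro s hs
    have hle : (t s : ℚ) ≤ t (s + 1) := by
      rw [← ht s hs.le, ← ht (s + 1) hs]
      exact mul_le_mul_of_nonneg_left (hg (Nat.le_succ s)) (Nat.cast_nonneg m)
    refine lt_of_le_of_ne (by exact_mod_cast hle) fun heq => ?_
    have h₁ : lamSeq b' n' s = lamSeq b' n' (s + 1) := by
      rw [← hval s hs.le, ← hval (s + 1) hs, heq]
    have h₂ := congrArg (fun v : QP ℓ => v.1 (b' ⟨s, hs⟩)) h₁
    simp only [lamSeq_fst, neg_inj, Int.cast_inj] at h₂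
    have hH := height_succ b' (b' ⟨s, hs⟩) ⟨s, hs⟩
    rw [if_pos rfl, if_neg (ne_sub_one _ hℓ)] at hH
    simp only at hH
    omega
  rw [← hval s hs, eq_id_of_strictMono hlt htm hs]

theorem eq_of_lamSeq_eq (hℓ : 1 ≤ ℓ) (hm : 0 < m) {b' : Fin m → Fin (ℓ + 1)} {n' : ℤ}
    (h : ∀ s ≤ m, lamSeq b n s = lamSeq b' n' s) : b = b' ∧ n = n' := by
  constructor
  · funext k
    have hH : ∀ s ≤ m, height b (b k) s = height b' (b k) s := fun s hs => by
      have := congrArg (fun v : QP ℓ => v.1 (b k)) (h s hs)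
      simpa only [lamSeq_fst, neg_inj, Int.cast_inj] using this
    have h₁ := height_succ b (b k) k
    have h₂ := height_succ b' (b k) k
    rw [if_pos rfl, if_neg (ne_sub_one _ hℓ), hH _ k.2.le, hH (k + 1) k.2] at h₁
    by_contra hne
    rw [if_neg (fun h => hne h.symm)] at h₂
    split_ifs at h₂ <;> omega
  · have := h m le_rfl
    rw [lamSeq_last b hm, lamSeq_last b' hm] at this
    exact congrArg Prod.snd (Path.toQP_injective this)

theorem psi_injective (hℓ : 1 ≤ ℓ) [NeZero m] : Function.Injective (psi ℓ m) := by
  have hm : 0 < m := Nat.pos_of_ne_zero (NeZero.ne m)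
  rintro ⟨b, n⟩ ⟨b', n'⟩ h
  have hself : (psiPath hm b' n').Visits m (lamSeq b' n') := by
    refine ⟨fun s => node (min_le_right s m), fun s t hst => ?_, fun s hs => ?_⟩
    · rw [le_node_iff hm, mul_node hm]
      exact_mod_cast min_le_min_right m hst
    · rw [toFun_psiPath, brokenFun_node hm, min_eq_left hs]
  have hvis : (psiPath hm b n).Visits m (lamSeq b' n') := by
    have := congrArg (Quot.lift (fun p : Path ℓ => p.Visits m (lamSeq b' n'))
      fun p₁ p₂ hp => propext (Path.visits_iff_of_reparam hp _)) h
    exact this.mpr hself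
  obtain ⟨rfl, rfl⟩ := eq_of_lamSeq_eq hℓ hm fun s hs => lamSeq_eq_of_visits hℓ hm hvis hs
  rfl

/-! ### The embedding `ψ` and the components -/

theorem psi_embeds (hℓ : 1 ≤ ℓ) [NeZero m] :
    CrystalOps.Embeds (BHat ℓ m) (pathCrystal ℓ) (psi ℓ m) := by
  have hm : 0 < m := Nat.pos_of_ne_zero (NeZero.ne m)
  have hcls : psi ℓ m = Path.cls ∘ fun x => psiPath hm x.1 x.2 := rfl
  have hε : ∀ i x, (BHat ℓ m).ε i x = (((psiPath hm x.1 x.2).eps i : ℤ) : WithBot ℤ) := by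
    rintro i ⟨b, n⟩
    obtain ⟨M, hM, hle, hex, -⟩ := exists_max b i hℓ hm
    rw [eps_psiPath hle hex]
    exact hM
  refine ⟨fun i x => ?_, fun i x => ?_, fun i x => (hε i x).symm, fun i x => ?_, fun x => rfl,
    psi_injective hℓ⟩
  · rw [hcls, ← Option.map_map, psiPath_e hℓ]
    rfl
  · rw [hcls, ← Option.map_map, psiPath_f hℓ]
    rfl
  · have h : (BHat ℓ m).φ i x = (BHat ℓ m).ε i x + (((BHat ℓ m).wt x).1 i : ℤ) := rfl
    rw [h, hε, ← WithBot.coe_add]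
    rfl

theorem psi_integral (hℓ : 1 ≤ ℓ) [NeZero m] (x : (Fin m → Fin (ℓ + 1)) × ℤ) :
    (psi ℓ m x).Integral := by
  have hm : 0 < m := Nat.pos_of_ne_zero (NeZero.ne m)
  intro i
  obtain ⟨M, -, hle, hex, -⟩ := exists_max x.1 i hℓ hm
  exact ⟨M, isGreatest_h_psiPath (hm := hm) hle hex⟩

theorem lamSeq_const_zero (hm : 0 < m) (n : ℤ) {s : ℕ} (hs : s ≤ m) :
    lamSeq (fun _ : Fin m => (0 : Fin (ℓ + 1))) n s =
      ((s : ℚ) / m) • toQP ((m : ℤ) • (Lam 1 - Lam 0 : P₀ ℓ), n) := by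
  have hm' : (m : ℚ) ≠ 0 := by exact_mod_cast hm.ne'
  have hrho : ∀ t < m, rho (fun _ : Fin m => (0 : Fin (ℓ + 1))) (t + 1) = 1 := fun t ht => by
    rw [rho_succ _ ht, Finset.card_eq_zero.2 (Finset.filter_eq_empty_iff.2 fun s _ => by
      simp [entry])]
  have hN : bigN (fun _ : Fin m => (0 : Fin (ℓ + 1))) = m := by
    rw [← sum_rho _ hm, Finset.sum_congr rfl fun t ht => by rw [hrho t (Finset.mem_range.1 ht)]]
    simp
  have hκ : kappa (fun _ : Fin m => (0 : Fin (ℓ + 1))) n s = s / m * n := by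
    rw [kappa_eq, hN, Finset.sum_congr rfl fun t ht => by
      rw [hrho t ((Finset.mem_range.1 ht).trans_le hs)]]
    simp only [Nat.cast_one, Finset.sum_const, Finset.card_range, nsmul_eq_mul, mul_one]
    push_cast
    field_simp
    ring
  have hcard : (Finset.univ.filter fun j : Fin m => (j : ℕ) < s).card = s := by
    rw [Fin.card_filter_val_lt, min_eq_right hs]
  rw [lamSeq, hκ, Finset.sum_const, hcard]
  ext j
  · simp only [toQP, Bl, zero_add, Prod.fst_add, Prod.smul_fst, Pi.add_apply, Pi.smul_apply,
      Pi.zero_apply, add_zero, smul_eq_mul, nsmul_eq_mul]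
    push_cast
    field_simp
  · simp [toQP]

theorem psi_bZero [NeZero m] (n : ℤ) :
    psi ℓ m (bZero ℓ m n) = (linearPath ((m : ℤ) • (Lam 1 - Lam 0 : P₀ ℓ), n)).cls := by
  have hm : 0 < m := Nat.pos_of_ne_zero (NeZero.ne m)
  have hm' : (m : ℚ) ≠ 0 := by exact_mod_cast hm.ne'
  refine congrArg Path.cls (Path.ext' fun τ => ?_)
  change brokenFun m (lamSeq (fun _ => 0) n) τ = (τ : ℚ) • toQP _
  obtain ⟨s, hs, h₁, h₂⟩ := exists_segment hm τ
  rw [brokenFun_eq _ h₁ h₂, lamSeq_const_zero hm n hs.le, lamSeq_const_zero hm n hs, ← sub_smul,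
    smul_smul, ← add_smul]
  congr 1
  push_cast
  field_simp
  ring

end Psi

end PathCrystal

open PathCrystal CrystalOps in
theorem theoremL25 (ℓ m : ℕ) [NeZero m] (hℓ : 1 ≤ ℓ) :
    -- source and target are normal crystals
    ((BHat ℓ m).IsCrystal (affineDatum ℓ) ∧ (BHat ℓ m).IsNormal) ∧
    ((pathCrystal ℓ).IsCrystal (affineDatum ℓ) ∧ (pathCrystal ℓ).IsNormal) ∧
    -- `ψ` is an injective strict morphism whose image has the integrality property
    Function.Injective (psi ℓ m) ∧
    IsStrictMorphism (BHat ℓ m) (pathCrystal ℓ) (Option.map (psi ℓ m)) ∧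
    (pathCrystal ℓ).IsSub (Set.range (psi ℓ m)) ∧
    (∀ p ∈ Set.range (psi ℓ m), p.Integral) ∧
    -- the components
    ∀ n : ℤ, (BHatComponent ℓ m n).Indecomposable ∧
      Isomorphic (BHatComponent ℓ m n)
        ((pathCrystal ℓ).generatedSub
          (linearPath ((m : ℤ) • (Lam 1 - Lam 0 : P₀ ℓ), n)).cls) := by
  have H := psi_embeds (m := m) hℓ
  have hP := pathCrystal_isCrystal hℓ
  have hN := pathCrystal_isNormal hℓ
  refine ⟨⟨H.isCrystal hP, H.isNormal hN⟩, ⟨hP, hN⟩, H.injective, H.isStrictMorphism,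
    H.isSub_range, ?_, fun n => ⟨indecomposable_generatedSub (H.isCrystal hP) _, ?_⟩⟩
  · rintro _ ⟨x, rfl⟩
    exact psi_integral hℓ x
  · rw [← psi_bZero]
    exact H.isomorphic_generatedSub (bZero ℓ m n)
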